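/- Let $n\ge 2$, $d_1,\dots,d_n\ge 1$, let $P_i=\sum_{|\alpha|=d_i}c_{i,\alpha}x^\alpha$ ($1\le i\le n$) be the generic homogeneous polynomials of degrees $d_i$ in $x_1,\dots,x_n$, and let $\mathbb A=\mathbb Z[c_{i,\alpha}]$ be the ring of their coefficients. Put $\rho=\sum_{i=1}^n(d_i-1)$. For $1\le i_1<\dots<i_s\le n$ let $H_{d_{i_1},\dots,d_{i_s}}(k)$ be the Hilbert function of a complete intersection of forms of these degrees in $n$ variables, i.e. the coefficient of $t^k$ in $\prod_{j}(1-t^{d_{i_j}})/(1-t)^n$ (and $0$ for $k<0$). For a set $S$ of $H_{d_1,\dots,d_n}(\nu)$ monomials of degree $\nu$, let $\Delta_S^\nu\in\mathbb A$ be the subresultant of $P_1,\dots,P_n$, defined up to sign as the greatest common divisor of the maximal minors of the matrix of the map $\bigoplus_i\mathbb A[x]_{\nu-d_i}\to\mathbb A[x]_\nu/\mathbb A\langle S\rangle$, $(Q_i)\mapsto\sum_iQ_iP_i$ (equivalently, the determinant of the corresponding degree-$\nu$ Koszul complex). Now let $\nu=\rho-\min\{d_i\}+1$. (a) Suppose $n=2$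 and $d_1>d_2\ge 1$, and let $S=\{x_1^kx_2^{\nu-k}: 0\le k<d_2\}$. Then $|S|=H_{d_1,d_2}(\nu)$ and $$\Delta_S^\nu=\pm c_0^{\,d_1-d_2},$$ where $c_0$ is the coefficient of $x_1^{d_2}$ in $P_2$. In particular, if $d_1-1>d_2$, then $\Delta_S^\nu$ is reducible in $\mathbb A$ (nonzero, not a unit and not irreducible). (b) Suppose $n>2$ and $d_1-1>d_2=\dots=d_n=1$, and let $S=\{x_1^\nu\}$. Then $|S|=H_{d_1,\dots,d_n}(\nu)$ and $$\Delta_S^\nu=\pm\delta^{\nu},$$ where $\delta=\det\left(c_{ji}\right)_{2\le i,j\le n}$ and $P_i=c_{1i}x_1+\dots+c_{ni}x_n$ for $2\le i\le n$. In particular, $\Delta_S^\nu$ is reducible in $\mathbb A$. Moreover, in both cases $\Delta_S^\nu$ is homogeneous of degree $H_{d_1,\dots,d_{i-1},d_{i+1},\dots,d_n}(\nu-d_i)$ in the coefficients of each $P_i$, and for every specialization of the coefficients to a field $K$, it is nonzero if and only if $I_\nu+K\langle S\rangle=K[x_1,\dots,x_n]_\nu$, where $I_\nu$ is the degree-$\nu$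 part of the ideal generated by the specialized $P_i$. Thus, in the condition $\nu>\rho-\min\{d_i\}+1$ for the irreducibility of all $\Delta_S^\nu$, the lower bound is sharp: irreducibility can fail for $\nu=\rho-\min\{d_i\}+1$. -/

import Mathlib

/-!
Multivariate subresultants of `n` generic homogeneous forms in `n` variables.

Variables, forms and degrees are indexed by `Fin n` (so index `0` is the first one), and a
monomial `x ^ α` is represented by its exponent `α : Fin n →₀ ℕ`.
-/

open MvPolynomial

universe u

/-- The exponents `α` of the monomials of degree `k` in `n` variables, i.e. `∑ i, α i = k`. -/
abbrev monoExps (n k : ℕ) : Finset (Fin n →₀ ℕ) :=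
  (Finset.univ : Finset (Fin n)).finsuppAntidiag k

/-- Indices `(i, α)`, `|α| = d i`, of the coefficients of the generic forms. -/
abbrev CoeffIndex {n : ℕ} (d : Fin n → ℕ) : Type :=
  Σ i : Fin n, {α : Fin n →₀ ℕ // α ∈ monoExps n (d i)}

/-- The universal coefficient ring `ℤ[c_{i,α}]`. -/
abbrev CoeffRing {n : ℕ} (d : Fin n → ℕ) : Type :=
  MvPolynomial (CoeffIndex d) ℤ

/-- The generic form `P_i = ∑_{|α| = d i} c_{i,α} x ^ α`. -/
noncomputable def genericForm {n : ℕ} (d : Fin n → ℕ) (i : Fin n) :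
    MvPolynomial (Fin n) (CoeffRing d) :=
  ∑ α : {α : Fin n →₀ ℕ // α ∈ monoExps n (d i)}, monomial α.1 (X ⟨i, α⟩)

/-- `ρ = ∑ i, (d i - 1)`. -/
def rho {n : ℕ} (d : Fin n → ℕ) : ℤ := ∑ i, ((d i : ℤ) - 1)

/-- The Hilbert function, at `k : ℤ`, of a complete intersection in `n` variables given by forms
of degrees `d i`, `i ∈ s`: the coefficient of `t ^ k` in `∏_{i ∈ s} (1 - t ^ d i) / (1 - t) ^ n`
(and `0` for negative `k`). -/
noncomputable def hilbertCI {n : ℕ} (d : Fin n → ℕ) (s : Finset (Fin n)) (k : ℤ) : ℤ :=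
  if k < 0 then 0 else
    PowerSeries.coeff k.toNat
      ((∏ i ∈ s, (1 - (PowerSeries.X : PowerSeries ℤ) ^ d i)) *
        ((PowerSeries.invOneSubPow ℤ n : (PowerSeries ℤ)ˣ) : PowerSeries ℤ))

/-- Indices `(i, β)` of the multiples `x ^ β * P_i` of degree `ν`, i.e. `|β| + d i = ν`. -/
abbrev MultIndex {n : ℕ} (d : Fin n → ℕ) (ν : ℕ) : Type :=
  Σ i : Fin n, {β : Fin n →₀ ℕ // β ∈ if d i ≤ ν then monoExps n (ν - d i) else ∅}

/-- The Macaulay matrix: the matrix, in the monomial bases, of the map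
`(Q_1, …, Q_n) ↦ Q_1 * P_1 + ⋯ + Q_n * P_n` from `⨁ i, A[x]_{ν - d i}` to `A[x]_ν / ⟨S⟩`. -/
noncomputable def macaulayMatrix {n : ℕ} (d : Fin n → ℕ) (ν : ℕ) (S : Finset (Fin n →₀ ℕ)) :
    Matrix {α : Fin n →₀ ℕ // α ∈ monoExps n ν \ S} (MultIndex d ν) (CoeffRing d) :=
  Matrix.of fun α b => coeff α.1 (monomial b.2.1 1 * genericForm d b.1)

/-- The maximal minor of the Macaulay matrix on the chosen columns. -/
noncomputable def macaulayMinor {n : ℕ} (d : Fin n → ℕ) (ν : ℕ) (S : Finset (Fin n →₀ ℕ))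
    (f : {α : Fin n →₀ ℕ // α ∈ monoExps n ν \ S} → MultIndex d ν) : CoeffRing d :=
  ((macaulayMatrix d ν S).submatrix id f).det

theorem exists_gcd_macaulayMinor {n : ℕ} (d : Fin n → ℕ) (ν : ℕ) (S : Finset (Fin n →₀ ℕ)) :
    ∃ Δ : CoeffRing d, ∀ g : CoeffRing d, g ∣ Δ ↔ ∀ f, g ∣ macaulayMinor d ν S f := by
  classical
  obtain ⟨inst⟩ := (inferInstance : Nonempty (NormalizedGCDMonoid (CoeffRing d)))
  refine ⟨(Finset.univ : Finset ({α : Fin n →₀ ℕ // α ∈ monoExps n ν \ S} →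
    MultIndex d ν)).gcd (macaulayMinor d ν S), fun g => ?_⟩
  simp [Finset.dvd_gcd_iff]

/-- The subresultant `Δ_S^ν` of the generic forms `P_1, …, P_n`, for a set `S` of
`hilbertCI d univ ν` monomials of degree `ν`: the greatest common divisor in `ℤ[c_{i,α}]` of the
maximal minors of the Macaulay matrix, which is well defined up to sign (one of the two is chosen).

Since generic forms are a regular sequence over `ℤ[c_{i,α}]`, this is the determinant of the
degree `ν` strand of their Koszul complex with last term taken modulo `⟨S⟩` (that complex is
acyclic as soon as it is generically exact, so its determinant is the greatest common divisor of
the maximal minors of its last map; both are zero otherwise). -/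
noncomputable def subresultant {n : ℕ} (d : Fin n → ℕ) (ν : ℕ) (S : Finset (Fin n →₀ ℕ)) :
    CoeffRing d :=
  (exists_gcd_macaulayMinor d ν S).choose

/-- The forms over a field `K` obtained by giving the coefficients `c_{i,α}` the values `a`. -/
noncomputable def specializedForm {n : ℕ} (d : Fin n → ℕ) {K : Type u} [Field K]
    (a : CoeffIndex d → K) (i : Fin n) : MvPolynomial (Fin n) K :=
  MvPolynomial.map (eval₂Hom (Int.castRingHom K) a) (genericForm d i)

/-- The two properties which go with a subresultant `Δ_S^ν`: it is homogeneous of degree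
`H_{d_1, …, d_{i-1}, d_{i+1}, …, d_n}(ν - d_i)` in the coefficients of each `P_i`, and for every
specialization of the coefficients to a field `K` it is nonzero if and only if
`I_ν + K⟨S⟩ = K[x_1, …, x_n]_ν`, where `I` is the ideal generated by the specialized forms. -/
structure HasSubresultantProperties {n : ℕ} (d : Fin n → ℕ) (ν : ℕ) (S : Finset (Fin n →₀ ℕ))
    (Δ : CoeffRing d) : Prop where
  degree : ∀ i : Fin n,
    IsWeightedHomogeneous (fun c : CoeffIndex d => if c.1 = i then (1 : ℤ) else 0) Δ
      (hilbertCI d (Finset.univ.erase i) ((ν : ℤ) - d i))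
  universal : ∀ (K : Type u) [Field K] (a : CoeffIndex d → K),
    eval₂Hom (Int.castRingHom K) a Δ ≠ 0 ↔
      ((Ideal.span (Set.range (specializedForm d a))).restrictScalars K ⊓
          homogeneousSubmodule (Fin n) K ν) ⊔
        Submodule.span K ((fun α => monomial α (1 : K)) '' (S : Set (Fin n →₀ ℕ))) =
      homogeneousSubmodule (Fin n) K ν

/-- A nonzero nonunit which is not irreducible. -/
def IsReducible {R : Type*} [CommRing R] (r : R) : Prop :=
  r ≠ 0 ∧ ¬ IsUnit r ∧ ¬ Irreducible r

/-! In both cases `ν` equals `d 0 - 1`, so the first form has too large a degree to contribute a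
column to the Macaulay matrix, and only the remaining forms matter.

For two binary forms the columns are the multiples of P₂ by monomials. They are as many as the rows,
and ordering rows and columns by the exponent of x₁ makes the matrix triangular with c₀ on the
diagonal (`macaulayMinor_leadColumn`). Every maximal minor is a multiple of this determinant, a
power of one variable.

For linear P₂, …, Pₙ, Cramer's rule gives a common zero q, polynomial in the coefficients, with
first coordinate δ. Evaluation of forms at q is a relation between the rows of the matrix and the
missing row of x₁^ν, whose weight is δ^ν. Since δ is prime and does not divide the other coordinates
of q, δ^ν divides every maximal minor (`linDet_pow_dvd_macaulayMinor`). Conversely, δ^ν x^α ≡ q^α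
x₁^ν modulo the ideal, so the Macaulay matrix has a right inverse up to the factor δ^ν, and the gcd
of the minors is a power of δ up to sign (`dvd_linDet_pow_of_dvd_macaulayMinor`). The exponent is
bounded above by one minor that specializes to 2^e with e ≤ ν while δ specializes to 2
(`exists_not_linDet_pow_dvd_macaulayMinor`).

Once the subresultant is an explicit power, its degrees and its vanishing are read off from c₀ or δ:
if this is nonzero, all monomials are reached by elimination; if it is zero, a common zero of the
forms on which S vanishes is an obstruction. -/

/-! ### Forms and the degree `ν` part of an ideal generated by forms -/

theorem mem_monoExps {n k : ℕ} {α : Fin n →₀ ℕ} : α ∈ monoExps n k ↔ α.degree = k := by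
  simp [monoExps, Finsupp.degree_eq_sum]

theorem isHomogeneous_genericForm {n : ℕ} (d : Fin n → ℕ) (i : Fin n) :
    (genericForm d i).IsHomogeneous (d i) :=
  IsHomogeneous.sum _ _ _ fun α _ => isHomogeneous_monomial _ (mem_monoExps.1 α.2)

theorem coeff_genericForm {n : ℕ} (d : Fin n → ℕ) (i : Fin n)
    (α : {α : Fin n →₀ ℕ // α ∈ monoExps n (d i)}) :
    coeff α.1 (genericForm d i) = X ⟨i, α⟩ := by
  classical
  rw [genericForm, coeff_sum, Finset.sum_eq_single α]
  · simp
  · intro β _ h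
    rw [coeff_monomial, if_neg fun h' => h (Subtype.ext h')]
  · simp

theorem isHomogeneous_specializedForm {n : ℕ} (d : Fin n → ℕ) {K : Type u} [Field K]
    (a : CoeffIndex d → K) (i : Fin n) : (specializedForm d a i).IsHomogeneous (d i) :=
  (isHomogeneous_genericForm d i).map _

theorem coeff_specializedForm {n : ℕ} (d : Fin n → ℕ) {K : Type u} [Field K]
    (a : CoeffIndex d → K) (i : Fin n) (α : Fin n →₀ ℕ) :
    coeff α (specializedForm d a i) =
      eval₂Hom (Int.castRingHom K) a (coeff α (genericForm d i)) := by
  rw [specializedForm, coeff_map]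

/-- The value of a form at a point, as a sum over all monomials of its degree. -/
theorem IsHomogeneous.eval_eq_sum_monoExps {R : Type*} [CommRing R] {n ν : ℕ}
    {f : MvPolynomial (Fin n) R} (hf : f.IsHomogeneous ν) (v : Fin n → R) :
    eval v f = ∑ α ∈ monoExps n ν, coeff α f * ∏ i, v i ^ α i := by
  rw [eval_eq']
  refine Finset.sum_subset (fun α hα => mem_monoExps.2 ?_) fun α _ hα => ?_
  · by_contra h
    exact mem_support_iff.1 hα (hf.coeff_eq_zero h)
  · rw [notMem_support_iff.1 hα, zero_mul]

theorem coeff_mul_eq_sum_monoExps {R : Type*} [CommRing R] {n e ν : ℕ}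
    {P : MvPolynomial (Fin n) R} (hP : P.IsHomogeneous e) (Q : MvPolynomial (Fin n) R)
    {α : Fin n →₀ ℕ} (hα : α ∈ monoExps n ν) :
    coeff α (Q * P) = ∑ β : {β : Fin n →₀ ℕ // β ∈ if e ≤ ν then monoExps n (ν - e) else ∅},
      coeff β.1 Q * coeff α (monomial β.1 1 * P) := by
  classical
  rw [mem_monoExps] at hα
  -- Both sums can be extended to the union of the support of `Q` and the index set: outside the
  -- index set the product with `P` has no term of degree `ν`.
  have hz : ∀ β, β ∉ (if e ≤ ν then monoExps n (ν - e) else ∅) →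
      coeff α (monomial β 1 * P) = 0 := by
    intro β hβ
    rw [coeff_monomial_mul']
    split_ifs with hle
    · rw [hP.coeff_eq_zero, mul_zero]
      intro hd
      have h1 : (α - β).degree + β.degree = α.degree := by
        rw [← map_add, tsub_add_cancel_of_le hle]
      apply hβ
      rw [if_pos (by omega), mem_monoExps]
      omega
    · rfl
  have hs : ∑ β : {β : Fin n →₀ ℕ // β ∈ if e ≤ ν then monoExps n (ν - e) else ∅},
      coeff β.1 Q * coeff α (monomial β.1 1 * P) =
      ∑ β ∈ (if e ≤ ν then monoExps n (ν - e) else ∅),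
        coeff β Q * coeff α (monomial β 1 * P) :=
    Finset.sum_coe_sort _ fun β => coeff β Q * coeff α (monomial β 1 * P)
  rw [hs]
  conv_lhs => rw [Q.as_sum, Finset.sum_mul, coeff_sum]
  have hc : ∀ β, coeff α (monomial β (coeff β Q) * P) =
      coeff β Q * coeff α (monomial β 1 * P) := by
    intro β
    rw [← coeff_C_mul, ← mul_assoc, C_mul_monomial, mul_one]
  simp_rw [hc]
  set U := if e ≤ ν then monoExps n (ν - e) else ∅
  rw [Finset.sum_subset (Finset.subset_union_left (s₁ := Q.support) (s₂ := U)),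
    Finset.sum_subset (Finset.subset_union_right (s₁ := Q.support) (s₂ := U))]
  · intro β _ h
    rw [hz β h, mul_zero]
  · intro β _ h
    rw [notMem_support_iff.1 h, zero_mul]

/-- In degree `ν`, the members of an ideal generated by forms are combinations of the multiples of
these forms by monomials. -/
theorem exists_coeff_eq_sum_multIndex {R : Type*} [CommRing R] {n : ℕ} {d : Fin n → ℕ}
    {P : Fin n → MvPolynomial (Fin n) R} (hP : ∀ i, (P i).IsHomogeneous (d i))
    {f : MvPolynomial (Fin n) R} (hf : f ∈ Ideal.span (Set.range P)) (ν : ℕ) :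
    ∃ r : MultIndex d ν → R, ∀ α ∈ monoExps n ν,
      coeff α f = ∑ b, r b * coeff α (monomial b.2.1 1 * P b.1) := by
  obtain ⟨Q, rfl⟩ := Ideal.mem_span_range_iff_exists_fun.1 hf
  refine ⟨fun b => coeff b.2.1 (Q b.1), fun α hα => ?_⟩
  rw [coeff_sum, Fintype.sum_sigma]
  exact Finset.sum_congr rfl fun i _ => coeff_mul_eq_sum_monoExps (hP i) _ hα

theorem isHomogeneous_monomial_mul {R : Type*} [CommRing R] {n : ℕ} {d : Fin n → ℕ}
    {P : Fin n → MvPolynomial (Fin n) R} (hP : ∀ i, (P i).IsHomogeneous (d i)) {ν : ℕ}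
    (b : MultIndex d ν) : (monomial b.2.1 1 * P b.1).IsHomogeneous ν := by
  have h2 := b.2.2
  split_ifs at h2 with hle
  · have := (isHomogeneous_monomial (1 : R) (mem_monoExps.1 h2)).mul (hP b.1)
    rwa [Nat.sub_add_cancel hle] at this
  · simp at h2

theorem MultIndex.le {n : ℕ} {d : Fin n → ℕ} {ν : ℕ} (b : MultIndex d ν) : d b.1 ≤ ν := by
  have h2 := b.2.2
  split_ifs at h2 with hle
  · exact hle
  · simp at h2

/-- Forms of degree `ν` in an ideal generated by forms vanish where those generators of degree at
most `ν` vanish. -/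
theorem eval_eq_zero_of_mem_span {R : Type*} [CommRing R] {n : ℕ} {d : Fin n → ℕ}
    {P : Fin n → MvPolynomial (Fin n) R} (hP : ∀ i, (P i).IsHomogeneous (d i)) {ν : ℕ}
    {v : Fin n → R} (hv : ∀ i, d i ≤ ν → eval v (P i) = 0)
    {f : MvPolynomial (Fin n) R} (hf : f ∈ Ideal.span (Set.range P)) (hν : f.IsHomogeneous ν) :
    eval v f = 0 := by
  obtain ⟨r, hr⟩ := exists_coeff_eq_sum_multIndex hP hf ν
  rw [IsHomogeneous.eval_eq_sum_monoExps hν, Finset.sum_congr rfl fun α hα => by rw [hr α hα]]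
  simp_rw [Finset.sum_mul]
  rw [Finset.sum_comm]
  refine Finset.sum_eq_zero fun b _ => ?_
  simp_rw [mul_assoc, ← Finset.mul_sum]
  rw [← IsHomogeneous.eval_eq_sum_monoExps (isHomogeneous_monomial_mul hP b), map_mul,
    hv _ b.le, mul_zero, mul_zero]

/-! ### Spanning of all forms of degree `ν` over a field -/

section Universal

variable {n : ℕ} {d : Fin n → ℕ} {K : Type u} [Field K] {a : CoeffIndex d → K} {ν : ℕ}
  {S : Finset (Fin n →₀ ℕ)}

theorem sup_span_eq_of_forall_monomial_mem (hS : S ⊆ monoExps n ν)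
    (h : ∀ α ∈ monoExps n ν, monomial α (1 : K) ∈
      ((Ideal.span (Set.range (specializedForm d a))).restrictScalars K ⊓
          homogeneousSubmodule (Fin n) K ν) ⊔
        Submodule.span K ((fun α => monomial α (1 : K)) '' (S : Set (Fin n →₀ ℕ)))) :
    ((Ideal.span (Set.range (specializedForm d a))).restrictScalars K ⊓
          homogeneousSubmodule (Fin n) K ν) ⊔
        Submodule.span K ((fun α => monomial α (1 : K)) '' (S : Set (Fin n →₀ ℕ))) =
      homogeneousSubmodule (Fin n) K ν := by
  apply le_antisymm
  · refine sup_le inf_le_right (Submodule.span_le.2 ?_)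
    rintro _ ⟨α, hα, rfl⟩
    exact isHomogeneous_monomial _ (mem_monoExps.1 (hS hα))
  · intro f hf
    rw [f.as_sum]
    refine Submodule.sum_mem _ fun α hα => ?_
    have h1 : monomial α (coeff α f) = coeff α f • monomial α (1 : K) := by
      rw [smul_monomial, smul_eq_mul, mul_one]
    rw [h1]
    refine Submodule.smul_mem _ _ (h α (mem_monoExps.2 ?_))
    by_contra h2
    exact mem_support_iff.1 hα (IsHomogeneous.coeff_eq_zero hf h2)

/-- Evaluation at `v` is a linear functional that kills the left-hand side but not every monomial of
degree `ν`. -/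
theorem sup_span_ne_of_eval_eq_zero (v : Fin n → K)
    (hv : ∀ i, d i ≤ ν → eval v (specializedForm d a i) = 0)
    (hS : ∀ α ∈ S, eval v (monomial α (1 : K)) = 0)
    (h : ∃ α ∈ monoExps n ν, eval v (monomial α (1 : K)) ≠ 0) :
    ((Ideal.span (Set.range (specializedForm d a))).restrictScalars K ⊓
          homogeneousSubmodule (Fin n) K ν) ⊔
        Submodule.span K ((fun α => monomial α (1 : K)) '' (S : Set (Fin n →₀ ℕ))) ≠
      homogeneousSubmodule (Fin n) K ν := by
  intro heq
  obtain ⟨α, hα, hne⟩ := h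
  have hle : ((Ideal.span (Set.range (specializedForm d a))).restrictScalars K ⊓
          homogeneousSubmodule (Fin n) K ν) ⊔
        Submodule.span K ((fun α => monomial α (1 : K)) '' (S : Set (Fin n →₀ ℕ))) ≤
      LinearMap.ker (aeval v : MvPolynomial (Fin n) K →ₐ[K] K).toLinearMap := by
    refine sup_le ?_ (Submodule.span_le.2 ?_)
    · rintro f ⟨hf, hh⟩
      simpa [aeval_eq_eval] using eval_eq_zero_of_mem_span (isHomogeneous_specializedForm d a)
        hv (by simpa using hf) hh
    · rintro _ ⟨β, hβ, rfl⟩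
      simpa [aeval_eq_eval] using hS β hβ
  have hm : monomial α (1 : K) ∈ homogeneousSubmodule (Fin n) K ν :=
    isHomogeneous_monomial _ (mem_monoExps.1 hα)
  rw [← heq] at hm
  exact hne (by simpa [aeval_eq_eval] using hle hm)

end Universal

/-! ### The gcd of the minors up to sign, and reducibility of powers -/

theorem dvd_subresultant_iff {n : ℕ} {d : Fin n → ℕ} {ν : ℕ} {S : Finset (Fin n →₀ ℕ)}
    {g : CoeffRing d} : g ∣ subresultant d ν S ↔ ∀ f, g ∣ macaulayMinor d ν S f :=
  (exists_gcd_macaulayMinor d ν S).choose_spec g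

theorem subresultant_dvd_macaulayMinor {n : ℕ} {d : Fin n → ℕ} {ν : ℕ}
    {S : Finset (Fin n →₀ ℕ)} (f) : subresultant d ν S ∣ macaulayMinor d ν S f :=
  dvd_subresultant_iff.1 dvd_rfl f

theorem eq_or_eq_neg_of_associated {σ : Type*} {p q : MvPolynomial σ ℤ} (h : Associated p q) :
    p = q ∨ p = -q := by
  obtain ⟨u, hu⟩ := h.symm
  obtain ⟨r, hr, hru⟩ := MvPolynomial.isUnit_iff_eq_C_of_isReduced.1 u.isUnit
  rcases Int.isUnit_iff.1 hr with rfl | rfl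
  · left; rw [← hu, hru]; simp
  · right; rw [← hu, hru]; simp

theorem isReducible_of_eq_pow {R : Type*} [CommRing R] [IsDomain R] {r x : R} {k : ℕ}
    (h : r = x ^ k ∨ r = -x ^ k) (hx : x ≠ 0) (hu : ¬ IsUnit x) (hk : 2 ≤ k) :
    IsReducible r := by
  have key : IsReducible (x ^ k) := ⟨pow_ne_zero _ hx, fun h => hu ((isUnit_pow_iff (by omega)).1 h),
    not_irreducible_pow (by omega)⟩
  rcases h with rfl | rfl
  · exact key
  · refine ⟨neg_ne_zero.2 key.1, fun h => key.2.1 (by simpa using h.neg), fun h => key.2.2 ?_⟩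
    exact (Associated.neg_left (Associated.refl _)).irreducible h

/-! ### Degree of a polynomial in a set of variables -/

section Scale

variable {σ : Type*} (T : Set σ) [DecidablePred (· ∈ T)]

/-- Scaling by a new variable of the variables in `T`. -/
noncomputable def scaleVars : MvPolynomial σ ℤ →+* Polynomial (MvPolynomial σ ℤ) :=
  (aeval fun s => (if s ∈ T then Polynomial.X else 1) * Polynomial.C (X s) :
    MvPolynomial σ ℤ →ₐ[ℤ] Polynomial (MvPolynomial σ ℤ)).toRingHom

theorem scaleVars_X (s : σ) :
    scaleVars T (X s) = (if s ∈ T then Polynomial.X else 1) * Polynomial.C (X s) := by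
  simp [scaleVars]

/-- Hence scaling is injective, and the degree in the new variable, which is the total degree in the
variables of `T`, is additive on nonzero products. -/
theorem eval_one_comp_scaleVars :
    (Polynomial.evalRingHom 1).comp (scaleVars T) = RingHom.id _ := by
  refine ringHom_ext (fun r => by simp) fun s => ?_
  by_cases hs : s ∈ T <;> simp [scaleVars_X, hs]

theorem eval_one_scaleVars (f : MvPolynomial σ ℤ) :
    (scaleVars T f).eval 1 = f :=
  congrArg (fun φ => φ f) (eval_one_comp_scaleVars T)

theorem scaleVars_injective : Function.Injective (scaleVars T) :=
  Function.LeftInverse.injective (g := Polynomial.eval 1) (eval_one_scaleVars T)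

/-- If the scaled polynomial is constant in the new variable, its values at 1 and at 0 agree. The
first is `f`, the second is `f` with the variables of `T` set to zero. -/
theorem notMem_vars_of_natDegree_scaleVars {f : MvPolynomial σ ℤ}
    (h : (scaleVars T f).natDegree = 0) {s : σ} (hs : s ∈ T) : s ∉ f.vars := by
  classical
  obtain ⟨a, ha⟩ := Polynomial.natDegree_eq_zero.1 h
  have h0 : (Polynomial.evalRingHom 0).comp (scaleVars T) =
      (bind₁ fun s => if s ∈ T then 0 else X s : MvPolynomial σ ℤ →ₐ[ℤ] _).toRingHom := by
    refine ringHom_ext (fun r => by simp) fun s => ?_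
    by_cases hs : s ∈ T <;> simp [scaleVars_X, hs]
  have h1' : a = f := by simpa [← ha] using eval_one_scaleVars T f
  have h0' : a = bind₁ (fun s => if s ∈ T then 0 else X s) f := by
    simpa [← ha] using congrArg (fun φ => φ f) h0
  intro hv
  rw [← h1', h0'] at hv
  have := vars_bind₁ _ _ hv
  simp only [Finset.mem_biUnion] at this
  obtain ⟨t, -, ht⟩ := this
  split_ifs at ht with htT
  · simp at ht
  · rw [vars_X, Finset.mem_singleton] at ht
    exact htT (ht ▸ hs)

theorem natDegree_scaleVars_mul {f g : MvPolynomial σ ℤ} (h : f * g ≠ 0) :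
    (scaleVars T (f * g)).natDegree =
      (scaleVars T f).natDegree + (scaleVars T g).natDegree := by
  rw [map_mul, Polynomial.natDegree_mul]
  · exact (map_ne_zero_iff _ (scaleVars_injective T)).2 (left_ne_zero_of_mul h)
  · exact (map_ne_zero_iff _ (scaleVars_injective T)).2 (right_ne_zero_of_mul h)

end Scale

/-! ### Irreducibility of the generic determinant -/

section Generic

variable {σ : Type*} {m : ℕ} {x : Fin m → Fin m → σ}

theorem exists_eval_genericDet (hx : Function.Injective2 x) (A : Matrix (Fin m) (Fin m) ℤ) :
    ∃ v : σ → ℤ, (∀ i j, v (x i j) = A i j) ∧ (∀ s, (∀ i j, s ≠ x i j) → v s = 0) ∧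
      eval v (Matrix.of fun i j => (X (x i j) : MvPolynomial σ ℤ)).det = A.det := by
  classical
  have key : ∀ i j, (fun s => if h : ∃ p : Fin m × Fin m, s = x p.1 p.2 then
      A h.choose.1 h.choose.2 else 0) (x i j) = A i j := by
    intro i j
    have h : ∃ p : Fin m × Fin m, x i j = x p.1 p.2 := ⟨(i, j), rfl⟩
    simp only [dif_pos h]
    obtain ⟨h1, h2⟩ := hx h.choose_spec
    rw [← h1, ← h2]
  refine ⟨fun s => if h : ∃ p : Fin m × Fin m, s = x p.1 p.2 then
      A h.choose.1 h.choose.2 else 0, key, fun s hs => dif_neg ?_, ?_⟩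
  · rintro ⟨p, hp⟩
    exact hs _ _ hp
  · rw [RingHom.map_det]
    congr 1
    ext i j
    simp only [RingHom.mapMatrix_apply, Matrix.map_apply, Matrix.of_apply, eval_X]
    exact key i j

theorem genericDet_ne_zero (hx : Function.Injective2 x) :
    (Matrix.of fun i j => (X (x i j) : MvPolynomial σ ℤ)).det ≠ 0 := by
  obtain ⟨v, -, -, hv⟩ := exists_eval_genericDet hx 1
  intro h
  simp [h] at hv

theorem natDegree_scaleVars_genericDet_row [DecidableEq σ] (hx : Function.Injective2 x)
    (i₀ : Fin m) [DecidablePred (· ∈ Set.range (x i₀))] :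
    (scaleVars (Set.range (x i₀))
      (Matrix.of fun i j => (X (x i j) : MvPolynomial σ ℤ)).det).natDegree = 1 := by
  have h : (scaleVars (Set.range (x i₀))).mapMatrix
      (Matrix.of fun i j => (X (x i j) : MvPolynomial σ ℤ)) =
      Matrix.of fun i j => (if i = i₀ then Polynomial.X else 1) *
        (Polynomial.C.mapMatrix (Matrix.of fun i j => (X (x i j) : MvPolynomial σ ℤ))) i j := by
    ext1 i j
    have : x i j ∈ Set.range (x i₀) ↔ i = i₀ :=
      ⟨fun ⟨k, hk⟩ => (hx hk).1.symm, fun h => ⟨j, by rw [h]⟩⟩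
    simp [scaleVars_X, this]
  rw [RingHom.map_det, h, Matrix.det_mul_column, ← RingHom.map_det, Finset.prod_ite_eq']
  simp [genericDet_ne_zero hx]

theorem natDegree_scaleVars_genericDet_col [DecidableEq σ] (hx : Function.Injective2 x)
    (j₀ : Fin m) [DecidablePred (· ∈ Set.range (x · j₀))] :
    (scaleVars (Set.range (x · j₀))
      (Matrix.of fun i j => (X (x i j) : MvPolynomial σ ℤ)).det).natDegree = 1 := by
  have h : (scaleVars (Set.range (x · j₀))).mapMatrix
      (Matrix.of fun i j => (X (x i j) : MvPolynomial σ ℤ)) =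
      Matrix.of fun i j => (if j = j₀ then Polynomial.X else 1) *
        (Polynomial.C.mapMatrix (Matrix.of fun i j => (X (x i j) : MvPolynomial σ ℤ))) i j := by
    ext1 i j
    have : x i j ∈ Set.range (x · j₀) ↔ j = j₀ :=
      ⟨fun ⟨k, hk⟩ => (hx hk).2.symm, fun h => ⟨i, by rw [h]⟩⟩
    simp [scaleVars_X, this]
  rw [RingHom.map_det, h, Matrix.det_mul_row, ← RingHom.map_det, Finset.prod_ite_eq']
  simp [genericDet_ne_zero hx]

theorem natDegree_scaleVars_genericDet_compl
    [DecidablePred (· ∈ {s : σ | ∀ i j, s ≠ x i j})] :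
    (scaleVars {s : σ | ∀ i j, s ≠ x i j}
      (Matrix.of fun i j => (X (x i j) : MvPolynomial σ ℤ)).det).natDegree = 0 := by
  have h : (scaleVars {s : σ | ∀ i j, s ≠ x i j}).mapMatrix
      (Matrix.of fun i j => (X (x i j) : MvPolynomial σ ℤ)) =
      Polynomial.C.mapMatrix (Matrix.of fun i j => (X (x i j) : MvPolynomial σ ℤ)) := by
    ext1 i j
    have : x i j ∉ {s : σ | ∀ i j, s ≠ x i j} := fun h => h i j rfl
    simp only [RingHom.mapMatrix_apply, Matrix.map_apply, Matrix.of_apply, scaleVars_X,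
      if_neg this, one_mul]
  rw [RingHom.map_det, h, ← RingHom.map_det, Polynomial.natDegree_C]

/-- A permutation matrix with a 1 at `(i, j)` and the same matrix with row `i` erased differ only at
that entry but have different determinants. -/
theorem mem_vars_genericDet (hx : Function.Injective2 x) (i j : Fin m) :
    x i j ∈ (Matrix.of fun i j => (X (x i j) : MvPolynomial σ ℤ)).det.vars := by
  classical
  by_contra h
  let A : Matrix (Fin m) (Fin m) ℤ := (Equiv.swap i j).permMatrix ℤ
  have hA : A i j = 1 := by simp [A, PEquiv.toMatrix]
  have hA' : ∀ k, k ≠ j → A i k = 0 := by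
    intro k hk
    simp [A, PEquiv.toMatrix, hk.symm]
  obtain ⟨v, hv, hv0, hvd⟩ := exists_eval_genericDet hx A
  obtain ⟨w, hw, hw0, hwd⟩ := exists_eval_genericDet hx (A.updateRow i 0)
  have hAd : A.det ≠ 0 := by simp [A, Matrix.det_permutation]
  have hBd : (A.updateRow i 0).det = 0 :=
    Matrix.det_eq_zero_of_row_eq_zero i (by simp)
  apply hAd
  rw [← hvd, ← hBd, ← hwd]
  refine eval₂Hom_congr' rfl (fun s hs _ => ?_) rfl
  by_cases hmat : ∃ k l, s = x k l
  · obtain ⟨k, l, rfl⟩ := hmat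
    rw [hv, hw]
    by_cases hk : k = i
    · subst hk
      have hl : l ≠ j := fun hl => h (hl ▸ hs)
      simp [hA' l hl]
    · simp [Matrix.updateRow_ne hk]
  · push Not at hmat
    rw [hv0 s hmat, hw0 s hmat]

/-- The determinant of a square matrix of distinct variables is irreducible. -/
theorem irreducible_genericDet (hm : 0 < m) (hx : Function.Injective2 x) :
    Irreducible (Matrix.of fun i j => (X (x i j) : MvPolynomial σ ℤ)).det := by
  classical
  set δ := (Matrix.of fun i j => (X (x i j) : MvPolynomial σ ℤ)).det with hδ
  have hδ0 : δ ≠ 0 := genericDet_ne_zero hx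
  -- The determinant has degree 1 in its first row, so one factor has degree 0 there; such a factor
  -- is shown to be a constant, and then a unit by evaluation at the identity matrix.
  have key : ∀ f g, δ = f * g → (scaleVars (Set.range (x ⟨0, hm⟩)) f).natDegree = 0 →
      IsUnit f := by
    intro f g hfg hf
    have hfg0 : f * g ≠ 0 := hfg ▸ hδ0
    have hvars : f.vars = ∅ := by
      refine Finset.eq_empty_of_forall_notMem fun s => ?_
      by_cases hs : ∃ i j, s = x i j
      · obtain ⟨i, j, rfl⟩ := hs
        refine notMem_vars_of_natDegree_scaleVars (Set.range (x · j)) ?_ ⟨i, rfl⟩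
        have h1 := natDegree_scaleVars_genericDet_col hx j
        rw [← hδ, hfg, natDegree_scaleVars_mul _ hfg0] at h1
        by_contra hne
        have hg : (scaleVars (Set.range (x · j)) g).natDegree = 0 := by omega
        -- If `f` had positive degree in column `j`, `g` would have degree 0 in it. The variable in
        -- the first row and column `j` would then occur in neither factor, though it occurs in the
        -- determinant.
        have h2 := mem_vars_genericDet hx ⟨0, hm⟩ j
        rw [← hδ, hfg] at h2
        rcases Finset.mem_union.1 (vars_mul _ _ h2) with h3 | h3
        · exact notMem_vars_of_natDegree_scaleVars _ hf ⟨j, rfl⟩ h3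
        · exact notMem_vars_of_natDegree_scaleVars _ hg ⟨_, rfl⟩ h3
      · push Not at hs
        refine notMem_vars_of_natDegree_scaleVars {s : σ | ∀ i j, s ≠ x i j} ?_ hs
        have h1 := natDegree_scaleVars_genericDet_compl (x := x)
        rw [← hδ, hfg, natDegree_scaleVars_mul _ hfg0] at h1
        omega
    obtain ⟨a, rfl⟩ : ∃ a, f = C a := ⟨_, (vars_eq_empty_iff_eq_C).1 hvars⟩
    obtain ⟨v, -, -, hv⟩ := exists_eval_genericDet hx 1
    rw [← hδ, hfg, Matrix.det_one, map_mul, eval_C] at hv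
    exact (IsUnit.of_mul_eq_one _ hv).map C
  refine ⟨fun hu => ?_, fun f g hfg => ?_⟩
  · obtain ⟨v, -, -, hv⟩ := exists_eval_genericDet hx 0
    have hu' := hu.map (eval v)
    have : Nonempty (Fin m) := ⟨⟨0, hm⟩⟩
    rw [hδ, hv, Matrix.det_zero] at hu'
    exact not_isUnit_zero hu'
  · have h1 := natDegree_scaleVars_genericDet_row hx ⟨0, hm⟩
    rw [← hδ, hfg, natDegree_scaleVars_mul _ (hfg ▸ hδ0)] at h1
    rcases Nat.eq_zero_or_pos (scaleVars (Set.range (x ⟨0, hm⟩)) f).natDegree with h2 | h2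
    · exact Or.inl (key f g hfg h2)
    · exact Or.inr (key g f (by rw [hfg, mul_comm]) (by omega))

end Generic

/-! ### Values of the Hilbert function -/

theorem coeff_one_sub_X_pow_mul (F : PowerSeries ℤ) (e k : ℕ) :
    PowerSeries.coeff k ((1 - (PowerSeries.X : PowerSeries ℤ) ^ e) * F) =
      PowerSeries.coeff k F - if e ≤ k then PowerSeries.coeff (k - e) F else 0 := by
  rw [sub_mul, one_mul, map_sub, PowerSeries.coeff_X_pow_mul']

theorem coeff_invOneSubPow_one (k : ℕ) :
    PowerSeries.coeff k (PowerSeries.invOneSubPow ℤ 1 : PowerSeries ℤ) = 1 := by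
  rw [PowerSeries.invOneSubPow_val_succ_eq_mk_add_choose]
  simp

theorem coeff_invOneSubPow_two (k : ℕ) :
    PowerSeries.coeff k (PowerSeries.invOneSubPow ℤ 2 : PowerSeries ℤ) = k + 1 := by
  rw [PowerSeries.invOneSubPow_val_succ_eq_mk_add_choose]
  simp [add_comm]

theorem hilbertCI_natCast {n : ℕ} (d : Fin n → ℕ) (s : Finset (Fin n)) (k : ℕ) :
    hilbertCI d s k = PowerSeries.coeff k
      ((∏ i ∈ s, (1 - (PowerSeries.X : PowerSeries ℤ) ^ d i)) *
        ((PowerSeries.invOneSubPow ℤ n : (PowerSeries ℤ)ˣ) : PowerSeries ℤ)) := by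
  rw [hilbertCI, if_neg (by omega), Int.toNat_natCast]

theorem hilbertCI_of_neg {n : ℕ} (d : Fin n → ℕ) (s : Finset (Fin n)) {k : ℤ} (hk : k < 0) :
    hilbertCI d s k = 0 := if_pos hk

section BinaryForms

variable {d : Fin 2 → ℕ} {ν : ℕ}

theorem hilbertCI_two_univ (h : d 1 ≤ ν) (hν : ν < d 0) :
    hilbertCI d Finset.univ ν = d 1 := by
  rw [hilbertCI_natCast, Fin.prod_univ_two, mul_assoc, coeff_one_sub_X_pow_mul,
    if_neg (by omega), coeff_one_sub_X_pow_mul, if_pos h, coeff_invOneSubPow_two,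
    coeff_invOneSubPow_two]
  push_cast [h]
  ring

theorem hilbertCI_two_erase_one (h : d 1 ≤ ν) (hν : ν < d 0) :
    hilbertCI d (Finset.univ.erase 1) ((ν : ℤ) - d 1) = ν - d 1 + 1 := by
  have h1 : (Finset.univ.erase 1 : Finset (Fin 2)) = {0} := rfl
  rw [← Nat.cast_sub h, hilbertCI_natCast, h1, Finset.prod_singleton, coeff_one_sub_X_pow_mul,
    if_neg (by omega), coeff_invOneSubPow_two]
  push_cast [h]
  ring

end BinaryForms

section LinearForms

variable {m : ℕ} {d : Fin (m + 1) → ℕ} {ν : ℕ}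

theorem hilbertCI_linear_univ (hd : ∀ i : Fin m, d i.succ = 1) (hν : ν < d 0) :
    hilbertCI d Finset.univ ν = 1 := by
  rw [hilbertCI_natCast, Fin.prod_univ_succ, mul_assoc, coeff_one_sub_X_pow_mul,
    if_neg (by omega)]
  simp only [hd, pow_one, Finset.prod_const, Finset.card_univ, Fintype.card_fin, sub_zero]
  rw [add_comm m 1, PowerSeries.one_sub_pow_mul_invOneSubPow_val_add_eq_invOneSubPow_val,
    coeff_invOneSubPow_one]

/-- The `m - 1` linear factors that remain reduce the series to (1 - t^(d 0)) / (1 - t)^2, and `d 0`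
is beyond the degree `ν - 1` considered. -/
theorem hilbertCI_linear_erase_succ (hd : ∀ i : Fin m, d i.succ = 1) (hν0 : 1 ≤ ν)
    (hν : ν < d 0) (i : Fin m) :
    hilbertCI d (Finset.univ.erase i.succ) ((ν : ℤ) - d i.succ) = ν := by
  have hprod : ∏ j ∈ Finset.univ.erase i.succ, (1 - (PowerSeries.X : PowerSeries ℤ) ^ d j) =
      (1 - PowerSeries.X ^ d 0) * (1 - PowerSeries.X) ^ (m - 1) := by
    rw [← Finset.mul_prod_erase _ _ (a := (0 : Fin (m + 1)))
      (Finset.mem_erase.2 ⟨(Fin.succ_ne_zero i).symm, Finset.mem_univ _⟩)]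
    congr 1
    rw [Finset.prod_eq_pow_card (b := 1 - PowerSeries.X)]
    · rw [Finset.card_erase_of_mem (by simp [(Fin.succ_ne_zero i).symm]),
        Finset.card_erase_of_mem (Finset.mem_univ _), Finset.card_univ, Fintype.card_fin]
      rfl
    · intro j hj
      obtain ⟨k, rfl⟩ := Fin.exists_succ_eq.2 (Finset.ne_of_mem_erase hj)
      rw [hd, pow_one]
  have hm : m + 1 = 2 + (m - 1) := by have := i.pos; omega
  rw [hd, Nat.cast_one, show ((ν : ℤ) - 1) = ((ν - 1 : ℕ) : ℤ) by omega, hilbertCI_natCast,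
    hprod, mul_assoc, coeff_one_sub_X_pow_mul, if_neg (by omega)]
  rw [congrArg (PowerSeries.invOneSubPow ℤ) hm,
    PowerSeries.one_sub_pow_mul_invOneSubPow_val_add_eq_invOneSubPow_val, coeff_invOneSubPow_two]
  omega

end LinearForms

/-! ### Two binary forms -/

theorem det_eq_prod_diag_of_injective {ι R : Type*} [Fintype ι] [DecidableEq ι] [CommRing R]
    {M : Matrix ι ι R} {w : ι → ℕ} (hw : Function.Injective w)
    (h : ∀ i j, w j < w i → M i j = 0) : M.det = ∏ i, M i i := by
  let _ : LinearOrder ι := LinearOrder.lift' w hw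
  convert! Matrix.det_of_isUpperTriangular (M := M) (fun i j hij => h i j hij)

section BinaryForms

variable {d : Fin 2 → ℕ} {ν : ℕ}

theorem degree_fin_two (α : Fin 2 →₀ ℕ) : α.degree = α 0 + α 1 := by
  rw [Finsupp.degree_eq_sum, Fin.sum_univ_two]

theorem card_filter_monoExps_two (p : ℕ → Prop) [DecidablePred p] :
    ((monoExps 2 ν).filter fun α => p (α 0)).card = ((Finset.range (ν + 1)).filter p).card := by
  refine Finset.card_bij (fun α _ => α 0) ?_ ?_ ?_
  · intro α hα
    rw [Finset.mem_filter, mem_monoExps, degree_fin_two] at hα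
    rw [Finset.mem_filter, Finset.mem_range]
    exact ⟨by omega, hα.2⟩
  · intro α hα β hβ h
    rw [Finset.mem_filter, mem_monoExps, degree_fin_two] at hα hβ
    ext i
    fin_cases i
    · exact h
    · change α 1 = β 1
      omega
  · intro k hk
    rw [Finset.mem_filter, Finset.mem_range] at hk
    refine ⟨Finsupp.single 0 k + Finsupp.single 1 (ν - k), ?_, by simp⟩
    rw [Finset.mem_filter, mem_monoExps, degree_fin_two]
    refine ⟨?_, by simpa using hk.2⟩
    simp
    omega

theorem card_filter_lt_monoExps_two {e : ℕ} (h : e ≤ ν) :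
    ((monoExps 2 ν).filter fun α => α 0 < e).card = e := by
  rw [card_filter_monoExps_two (· < e)]
  have : (Finset.range (ν + 1)).filter (· < e) = Finset.range e := by
    ext k
    simp
    omega
  rw [this, Finset.card_range]

theorem card_filter_not_lt_monoExps_two (e : ℕ) :
    ((monoExps 2 ν) \ (monoExps 2 ν).filter fun α => α 0 < e).card = ν + 1 - e := by
  rw [← Finset.filter_not, card_filter_monoExps_two (¬ · < e)]
  have : (Finset.range (ν + 1)).filter (¬ · < e) = Finset.Ico e (ν + 1) := by
    ext k
    simp
    omega
  rw [this, Nat.card_Ico]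

/-- The leading coefficient of the second of two binary forms. -/
noncomputable abbrev leadCoeff (d : Fin 2 → ℕ) : CoeffRing d :=
  coeff (Finsupp.single 0 (d 1)) (genericForm d 1)

/-- The exponents of degree `ν` whose first entry is less than `d 1`. -/
abbrev lowExps (d : Fin 2 → ℕ) (ν : ℕ) : Finset (Fin 2 →₀ ℕ) :=
  (monoExps 2 ν).filter (fun α => α 0 < d 1)

theorem leadCoeff_eq_X (d : Fin 2 → ℕ) :
    leadCoeff d = X ⟨1, ⟨Finsupp.single 0 (d 1), mem_monoExps.2 (by simp)⟩⟩ :=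
  coeff_genericForm d 1 ⟨Finsupp.single 0 (d 1), _⟩

theorem mem_sdiff_lowExps {α : Fin 2 →₀ ℕ} :
    α ∈ monoExps 2 ν \ lowExps d ν ↔ α 0 + α 1 = ν ∧ d 1 ≤ α 0 := by
  rw [← Finset.filter_not, Finset.mem_filter, mem_monoExps, degree_fin_two, not_lt]

/-- The column `x ^ (α - (d 1, 0)) * P₂` having `c₀` in the row `α`. -/
noncomputable def leadColumn (d : Fin 2 → ℕ) (ν : ℕ)
    (α : {α : Fin 2 →₀ ℕ // α ∈ monoExps 2 ν \ lowExps d ν}) : MultIndex d ν :=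
  ⟨1, α.1 - Finsupp.single 0 (d 1), by
    obtain ⟨h1, h2⟩ := mem_sdiff_lowExps.1 α.2
    rw [if_pos (by omega), mem_monoExps, degree_fin_two]
    simp
    omega⟩

/-- As `ν < d 0`, all columns are multiples of the second form; each monomial multiplier β is hit by
the row β + (d 1, 0). -/
theorem leadColumn_surjective (hν : ν < d 0) : Function.Surjective (leadColumn d ν) := by
  rintro ⟨i, β, hβ⟩
  have hi : d i ≤ ν := MultIndex.le ⟨i, β, hβ⟩
  obtain rfl : i = 1 := by
    fin_cases i
    · simp at hi
      omega
    · rfl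
  have hβ' := hβ
  rw [if_pos hi, mem_monoExps, degree_fin_two] at hβ'
  refine ⟨⟨β + Finsupp.single 0 (d 1), mem_sdiff_lowExps.2 ?_⟩, ?_⟩
  · simp
    omega
  · simp [leadColumn]

theorem macaulayMinor_leadColumn :
    macaulayMinor d ν (lowExps d ν) (leadColumn d ν) = leadCoeff d ^ (ν + 1 - d 1) := by
  classical
  have hinj : Function.Injective
      fun α : {α : Fin 2 →₀ ℕ // α ∈ monoExps 2 ν \ lowExps d ν} => α.1 0 := by
    intro α β hab
    obtain ⟨h1, -⟩ := mem_sdiff_lowExps.1 α.2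
    obtain ⟨h2, -⟩ := mem_sdiff_lowExps.1 β.2
    ext i
    fin_cases i
    · exact hab
    · change α.1 0 = β.1 0 at hab
      change α.1 1 = β.1 1
      omega
  -- P₂ contains no power of x₁ above `d 1`, so the column attached to `β` has no monomial with
  -- x₁-exponent above `β 0`.
  have htri : ∀ α β : {α : Fin 2 →₀ ℕ // α ∈ monoExps 2 ν \ lowExps d ν}, β.1 0 < α.1 0 →
      (macaulayMatrix d ν (lowExps d ν)).submatrix id (leadColumn d ν) α β = 0 := by
    intro α β hlt
    obtain ⟨h1, h1'⟩ := mem_sdiff_lowExps.1 α.2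
    obtain ⟨h2, h2'⟩ := mem_sdiff_lowExps.1 β.2
    simp only [macaulayMatrix, Matrix.submatrix_apply, Matrix.of_apply, id_eq, leadColumn,
      coeff_monomial_mul']
    split_ifs with hle
    · rw [(isHomogeneous_genericForm d 1).coeff_eq_zero, mul_zero]
      rw [degree_fin_two]
      simp
      omega
    · rfl
  have hdet := det_eq_prod_diag_of_injective hinj htri
  have hdiag : ∀ α, (macaulayMatrix d ν (lowExps d ν)).submatrix id (leadColumn d ν) α α =
      leadCoeff d := by
    intro α
    obtain ⟨h1, h1'⟩ := mem_sdiff_lowExps.1 α.2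
    have hle : Finsupp.single 0 (d 1) ≤ α.1 := by
      rwa [Finsupp.single_le_iff]
    simp only [macaulayMatrix, Matrix.submatrix_apply, Matrix.of_apply, id_eq, leadColumn]
    conv_lhs => rw [← tsub_add_cancel_of_le hle]
    rw [add_tsub_cancel_right, coeff_monomial_mul, one_mul]
  simp only [hdiag, Finset.prod_const, Finset.card_univ, Fintype.card_coe] at hdet
  rw [card_filter_not_lt_monoExps_two] at hdet
  rw [← hdet, macaulayMinor]

/-- Any choice of columns factors through `leadColumn`, so its minor is the full determinant times
the determinant of a 0-1 selection matrix. -/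
theorem leadCoeff_pow_dvd_macaulayMinor (hν : ν < d 0) (f) :
    leadCoeff d ^ (ν + 1 - d 1) ∣ macaulayMinor d ν (lowExps d ν) f := by
  classical
  choose τ hτ using fun α => leadColumn_surjective hν (f α)
  have : (macaulayMatrix d ν (lowExps d ν)).submatrix id f =
      (macaulayMatrix d ν (lowExps d ν)).submatrix id (leadColumn d ν) *
        (1 : Matrix _ _ (CoeffRing d)).submatrix id τ := by
    ext1 α β
    simp [Matrix.mul_apply, Matrix.one_apply, hτ]
  rw [macaulayMinor, this, Matrix.det_mul, ← macaulayMinor_leadColumn, macaulayMinor]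
  exact dvd_mul_right _ _

theorem subresultant_lowExps (hν : ν < d 0) :
    subresultant d ν (lowExps d ν) = leadCoeff d ^ (ν + 1 - d 1) ∨
      subresultant d ν (lowExps d ν) = -leadCoeff d ^ (ν + 1 - d 1) :=
  eq_or_eq_neg_of_associated <| associated_of_dvd_dvd
    (macaulayMinor_leadColumn ▸ subresultant_dvd_macaulayMinor _)
    (dvd_subresultant_iff.2 (leadCoeff_pow_dvd_macaulayMinor hν))

/-- Division by P₂, by induction on the exponent of x₁: a monomial outside S is the leading term of
a multiple of P₂, whose other terms have smaller x₁-exponent. -/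
theorem monomial_mem_of_leadCoeff_ne_zero {K : Type u} [Field K] {a : CoeffIndex d → K}
    (ha : eval₂Hom (Int.castRingHom K) a (leadCoeff d) ≠ 0) :
    ∀ k, ∀ α ∈ monoExps 2 ν, α 0 = k → monomial α (1 : K) ∈
      ((Ideal.span (Set.range (specializedForm d a))).restrictScalars K ⊓
          homogeneousSubmodule (Fin 2) K ν) ⊔
        Submodule.span K ((fun α => monomial α (1 : K)) ''
          (lowExps d ν : Set (Fin 2 →₀ ℕ))) := by
  intro k
  induction k using Nat.strong_induction_on with
  | _ k ih =>
  intro α hα hk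
  set V := ((Ideal.span (Set.range (specializedForm d a))).restrictScalars K ⊓
          homogeneousSubmodule (Fin 2) K ν) ⊔
        Submodule.span K ((fun α => monomial α (1 : K)) '' (lowExps d ν : Set (Fin 2 →₀ ℕ)))
  by_cases hlt : α 0 < d 1
  · refine Submodule.mem_sup_right (Submodule.subset_span ⟨α, ?_, rfl⟩)
    exact Finset.mem_coe.2 (Finset.mem_filter.2 ⟨hα, hlt⟩)
  push Not at hlt
  have hle : Finsupp.single 0 (d 1) ≤ α := by rwa [Finsupp.single_le_iff]
  set β := α - Finsupp.single 0 (d 1) with hβ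
  have hβα : β + Finsupp.single 0 (d 1) = α := tsub_add_cancel_of_le hle
  set c := eval₂Hom (Int.castRingHom K) a (leadCoeff d) with hc
  set f := monomial β 1 * specializedForm d a 1 with hf
  have hfh : f.IsHomogeneous ν := by
    have h1 := (isHomogeneous_monomial (1 : K) (rfl : β.degree = β.degree)).mul
      (isHomogeneous_specializedForm d a 1)
    have h2 : β.degree + d 1 = ν := by
      rw [← mem_monoExps.1 hα, ← hβα, map_add, Finsupp.degree_single]
    rwa [h2] at h1
  have hfV : f ∈ V := Submodule.mem_sup_left
    ⟨Ideal.mul_mem_left _ _ (Ideal.subset_span ⟨1, rfl⟩), hfh⟩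
  have hcoeff : coeff α f = c := by
    rw [hf, ← hβα, coeff_monomial_mul, one_mul, coeff_specializedForm]
  have hsmul : ∀ γ, monomial γ (coeff γ f) = coeff γ f • monomial γ (1 : K) := fun γ => by
    rw [smul_monomial, smul_eq_mul, mul_one]
  have hsum : f = c • monomial α (1 : K) +
      ∑ γ ∈ f.support.erase α, coeff γ f • monomial γ (1 : K) := by
    rw [← hcoeff]
    conv_lhs => rw [f.as_sum]
    simp_rw [hsmul]
    rw [Finset.add_sum_erase _ fun γ => coeff γ f • monomial γ (1 : K)]
    exact mem_support_iff.2 (by rwa [hcoeff])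
  have hrest : ∑ γ ∈ f.support.erase α, coeff γ f • monomial γ (1 : K) ∈ V := by
    refine Submodule.sum_mem _ fun γ hγ => Submodule.smul_mem _ _ ?_
    obtain ⟨hne, hγ⟩ := Finset.mem_erase.1 hγ
    rw [mem_support_iff] at hγ
    have hγν : γ ∈ monoExps 2 ν := mem_monoExps.2 (by
      by_contra h
      exact hγ (hfh.coeff_eq_zero h))
    refine ih (γ 0) ?_ γ hγν rfl
    have hlast : γ 0 ≤ α 0 := by
      rw [hf, coeff_monomial_mul'] at hγ
      split_ifs at hγ with hβγ
      · by_contra hgt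
        apply hγ
        rw [(isHomogeneous_specializedForm d a 1).coeff_eq_zero, mul_zero]
        have h0 := congrArg (· 0) hβα
        simp at h0
        rw [degree_fin_two, Finsupp.tsub_apply]
        omega
      · exact absurd rfl hγ
    rw [← hk]
    refine lt_of_le_of_ne hlast fun heq => hne ?_
    rw [mem_monoExps, degree_fin_two] at hγν hα
    ext i
    fin_cases i
    · exact heq
    · change γ 1 = α 1
      omega
  have : monomial α (1 : K) =
      c⁻¹ • (f - ∑ γ ∈ f.support.erase α, coeff γ f • monomial γ (1 : K)) := by
    rw [eq_inv_smul_iff₀ ha]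
    nth_rewrite 1 [hsum]
    rw [add_sub_cancel_right]
  rw [this]
  exact Submodule.smul_mem _ _ (Submodule.sub_mem _ hfV hrest)

theorem leadCoeff_ne_zero_iff (h : d 1 ≤ ν) (hν : ν < d 0) (K : Type u) [Field K]
    (a : CoeffIndex d → K) :
    eval₂Hom (Int.castRingHom K) a (leadCoeff d) ≠ 0 ↔
      ((Ideal.span (Set.range (specializedForm d a))).restrictScalars K ⊓
          homogeneousSubmodule (Fin 2) K ν) ⊔
        Submodule.span K ((fun α => monomial α (1 : K)) ''
          (lowExps d ν : Set (Fin 2 →₀ ℕ))) =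
      homogeneousSubmodule (Fin 2) K ν := by
  refine ⟨fun ha => sup_span_eq_of_forall_monomial_mem (Finset.filter_subset _ _)
    fun α hα => monomial_mem_of_leadCoeff_ne_zero ha _ α hα rfl, ?_⟩
  contrapose!
  intro ha
  -- At the point (1, 0) the second form takes the value c₀ = 0, the monomials of S vanish because
  -- their x₁-exponent is less than `d 1 ≤ ν`, and x₁^ν does not vanish.
  refine sup_span_ne_of_eval_eq_zero ![1, 0] ?_ ?_ ?_
  · intro i hi
    obtain rfl : i = 1 := by
      fin_cases i
      · simp at hi
        omega
      · rfl
    rw [IsHomogeneous.eval_eq_sum_monoExps (isHomogeneous_specializedForm d a 1),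
      Finset.sum_eq_zero]
    intro α hα
    rw [mem_monoExps, degree_fin_two] at hα
    by_cases h1 : α 1 = 0
    · have : α = Finsupp.single 0 (d 1) := by
        ext i
        fin_cases i
        · simp; omega
        · simp [h1]
      rw [coeff_specializedForm, this, ha, zero_mul]
    · simp [Fin.prod_univ_two, h1]
  · intro α hα
    rw [Finset.mem_filter, mem_monoExps, degree_fin_two] at hα
    rw [eval_monomial, Finsupp.prod_fintype _ _ (by simp), Fin.prod_univ_two]
    have : α 1 ≠ 0 := by omega
    simp [this]
  · refine ⟨Finsupp.single 0 ν, mem_monoExps.2 (by simp), ?_⟩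
    simp [eval_monomial]

theorem hasSubresultantProperties_lowExps (h : d 1 ≤ ν) (hν : d 0 = ν + 1) :
    HasSubresultantProperties.{u} d ν (lowExps d ν) (subresultant d ν (lowExps d ν)) := by
  have hpow := subresultant_lowExps (by omega : ν < d 0)
  constructor
  · intro i
    have hw : IsWeightedHomogeneous (fun c : CoeffIndex d => if c.1 = i then (1 : ℤ) else 0)
        (leadCoeff d ^ (ν + 1 - d 1))
        (hilbertCI d (Finset.univ.erase i) ((ν : ℤ) - d i)) := by
      have h1 := ((leadCoeff_eq_X d) ▸ isWeightedHomogeneous_X ℤ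
        (fun c : CoeffIndex d => if c.1 = i then (1 : ℤ) else 0) _).pow (ν + 1 - d 1)
      convert h1 using 1
      fin_cases i
      -- For the first form the Hilbert function is taken at `ν - d 0 = -1`.
      · rw [hilbertCI_of_neg _ _ (by simp; omega)]
        simp
      · have h2 := hilbertCI_two_erase_one h (by omega : ν < d 0)
        simp at h2 ⊢
        rw [h2]
        omega
    rcases hpow with hp | hp <;> rw [hp]
    · exact hw
    · exact hw.neg
  · intro K _ a
    rw [← leadCoeff_ne_zero_iff h (by omega : ν < d 0)]
    have : ν + 1 - d 1 ≠ 0 := by omega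
    rcases hpow with hp | hp <;> rw [hp] <;> simp [this]

end BinaryForms

/-! ### Cramer's rule for linear forms -/

theorem IsHomogeneous.eq_sum_C_mul_X {R : Type*} [CommRing R] {n : ℕ}
    {P : MvPolynomial (Fin n) R} (hP : P.IsHomogeneous 1) :
    P = ∑ j, C (coeff (Finsupp.single j 1) P) * X j := by
  classical
  have h1 : P ∈ homogeneousSubmodule (Fin n) R 1 := hP
  rw [homogeneousSubmodule_one_eq_span_X, Submodule.mem_span_range_iff_exists_fun] at h1
  obtain ⟨r, rfl⟩ := h1
  refine Finset.sum_congr rfl fun j _ => ?_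
  rw [smul_eq_C_mul, coeff_sum, Finset.sum_eq_single j]
  · simp
  · intro k _ hk
    simp [coeff_X, Finsupp.single_left_inj, hk]
  · simp

section LinearSystem

variable {R : Type*} [CommRing R] {m : ℕ} (c : Matrix (Fin m) (Fin (m + 1)) R)

/-- The square matrix obtained by omitting the first column. -/
def tailMatrix : Matrix (Fin m) (Fin m) R := Matrix.of fun i j => c i j.succ

/-- The solution of the linear system `c * q = 0` given by the Cramer rule. -/
noncomputable def cramerSolution : Fin (m + 1) → R :=
  Fin.cons (tailMatrix c).det fun j => -(tailMatrix c).cramer (fun i => c i 0) j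

theorem cramerSolution_zero : cramerSolution c 0 = (tailMatrix c).det := rfl

theorem cramerSolution_succ (j : Fin m) :
    cramerSolution c j.succ = -(tailMatrix c).cramer (fun i => c i 0) j := rfl

theorem sum_mul_cramerSolution (i : Fin m) : ∑ j, c i j * cramerSolution c j = 0 := by
  have h := congrFun (Matrix.mulVec_cramer (tailMatrix c) fun i => c i 0) i
  simp only [Matrix.mulVec, dotProduct, Pi.smul_apply, smul_eq_mul] at h
  rw [Fin.sum_univ_succ, cramerSolution_zero]
  simp only [cramerSolution_succ, mul_neg, Finset.sum_neg_distrib]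
  have h2 : ∀ j, tailMatrix c i j = c i j.succ := fun j => rfl
  simp only [h2] at h
  rw [h]
  ring

/-- Multiplying the system of linear forms by the adjugate of the tail matrix eliminates all
variables but `X j` and `X 0`. -/
theorem C_det_mul_X_sub_mem {I : Ideal (MvPolynomial (Fin (m + 1)) R)}
    (hI : ∀ i, ∑ j, C (c i j) * X j ∈ I) (j : Fin (m + 1)) :
    C (tailMatrix c).det * X j - C (cramerSolution c j) * X 0 ∈ I := by
  refine Fin.cases ?_ (fun j => ?_) j
  · rw [cramerSolution_zero, sub_self]
    exact I.zero_mem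
  · have h : C (tailMatrix c).det * X j.succ - C (cramerSolution c j.succ) * X 0 =
        ∑ i, C ((tailMatrix c).adjugate j i) * ∑ k, C (c i k) * X k := by
      have hadj : ∀ k, ∑ i, (tailMatrix c).adjugate j i * c i k.succ =
          if j = k then (tailMatrix c).det else 0 := by
        intro k
        have := congrFun (congrFun (Matrix.adjugate_mul (tailMatrix c)) j) k
        rw [Matrix.mul_apply, Matrix.smul_apply, Matrix.one_apply, smul_eq_mul, mul_ite, mul_one,
          mul_zero] at this
        exact this
      have hcr : (tailMatrix c).cramer (fun i => c i 0) j =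
          ∑ i, (tailMatrix c).adjugate j i * c i 0 := by
        rw [Matrix.cramer_eq_adjugate_mulVec]
        rfl
      simp_rw [Finset.mul_sum, ← mul_assoc, ← C_mul]
      rw [Finset.sum_comm]
      simp_rw [← Finset.sum_mul, ← map_sum]
      rw [Fin.sum_univ_succ]
      simp_rw [hadj]
      have hs : ∑ k, C (if j = k then (tailMatrix c).det else 0) * X k.succ =
          (C (tailMatrix c).det * X j.succ : MvPolynomial (Fin (m + 1)) R) := by
        rw [Finset.sum_eq_single j]
        · rw [if_pos rfl]
        · intro k _ hk
          rw [if_neg hk.symm, C_0, zero_mul]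
        · simp
      rw [cramerSolution_succ, hcr, hs, C_neg]
      ring
    rw [h]
    exact I.sum_mem fun i _ => I.mul_mem_left _ (hI i)

/-- Product of the congruences δ xⱼ ≡ qⱼ x₁ modulo `I`, each taken `α j` times. -/
theorem C_det_pow_mul_monomial_sub_mem {I : Ideal (MvPolynomial (Fin (m + 1)) R)}
    (hI : ∀ i, ∑ j, C (c i j) * X j ∈ I) {ν : ℕ} {α : Fin (m + 1) →₀ ℕ}
    (hα : α ∈ monoExps (m + 1) ν) :
    C ((tailMatrix c).det ^ ν) * monomial α 1 -
      C (∏ j, cramerSolution c j ^ α j) * monomial (Finsupp.single 0 ν) 1 ∈ I := by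
  rw [mem_monoExps, Finsupp.degree_eq_sum] at hα
  have h1 : C ((tailMatrix c).det ^ ν) * monomial α 1 =
      ∏ j, (C (tailMatrix c).det * X j : MvPolynomial (Fin (m + 1)) R) ^ α j := by
    simp_rw [mul_pow]
    rw [Finset.prod_mul_distrib, Finset.prod_pow_eq_pow_sum, hα, map_pow, monomial_eq,
      Finsupp.prod_fintype _ _ (by simp), C_1, one_mul]
  have h2 : C (∏ j, cramerSolution c j ^ α j) * monomial (Finsupp.single 0 ν) 1 =
      ∏ j, (C (cramerSolution c j) * X 0 : MvPolynomial (Fin (m + 1)) R) ^ α j := by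
    simp_rw [mul_pow]
    rw [Finset.prod_mul_distrib, Finset.prod_pow_eq_pow_sum, hα, map_prod]
    simp_rw [map_pow]
    rw [X_pow_eq_monomial]
  rw [h1, h2, ← Ideal.Quotient.mk_eq_mk_iff_sub_mem, map_prod, map_prod]
  refine Finset.prod_congr rfl fun j _ => ?_
  rw [map_pow, map_pow]
  congr 1
  exact Ideal.Quotient.mk_eq_mk_iff_sub_mem _ _ |>.2 (C_det_mul_X_sub_mem c hI j)

end LinearSystem

/-- Divisors of all maximal minors of a matrix divide the determinants obtained from it by
multiplication on the right. -/
theorem dvd_det_mul_of_forall_dvd_det_submatrix {R ι κ : Type*} [CommRing R] [Fintype ι]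
    [DecidableEq ι] [Fintype κ] {M : Matrix ι κ R} {g : R}
    (h : ∀ f : ι → κ, g ∣ (M.submatrix id f).det) (N : Matrix κ ι R) : g ∣ (M * N).det := by
  classical
  -- The columns of `M * N` are combinations of columns of `M`; multilinear expansion leaves
  -- multiples of minors of `M`, possibly with repeated columns.
  have h1 : (M * N).det = Matrix.detRowAlternating.toMultilinearMap
      fun i => ∑ b, N b i • M.transpose b := by
    rw [← Matrix.det_transpose]
    change _ = Matrix.det _
    congr 1
    ext1 i j
    simp [Matrix.mul_apply, mul_comm]
  rw [h1, MultilinearMap.map_sum]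
  refine Finset.dvd_sum fun f _ => ?_
  rw [MultilinearMap.map_smul_univ]
  refine Dvd.dvd.mul_left ?_ _
  have h2 : Matrix.detRowAlternating.toMultilinearMap (fun i => M.transpose (f i)) =
      (M.submatrix id f).det := by
    rw [← Matrix.det_transpose (M.submatrix id f)]
    rfl
  rw [h2]
  exact h f

/-! ### The subresultant for linear forms -/

section LinearForms

variable {m : ℕ} {d : Fin (m + 1) → ℕ} {ν : ℕ}

/-- The coefficients of the linear forms. -/
noncomputable def linCoeff (d : Fin (m + 1) → ℕ) :
    Matrix (Fin m) (Fin (m + 1)) (CoeffRing d) :=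
  Matrix.of fun i j => coeff (Finsupp.single j 1) (genericForm d i.succ)

/-- The determinant of the coefficients of `x₂, …, xₙ`. -/
noncomputable abbrev linDet (d : Fin (m + 1) → ℕ) : CoeffRing d :=
  (Matrix.of fun i j : Fin m => coeff (Finsupp.single j.succ 1) (genericForm d i.succ)).det

theorem det_tailMatrix_linCoeff (d : Fin (m + 1) → ℕ) :
    (tailMatrix (linCoeff d)).det = linDet d := rfl

theorem det_tailMatrix_map {R : Type*} [CommRing R] (φ : CoeffRing d →+* R) :
    (tailMatrix ((linCoeff d).map φ)).det = φ (linDet d) := by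
  rw [← det_tailMatrix_linCoeff, RingHom.map_det]
  rfl

theorem genericForm_succ_eq (hd : ∀ i : Fin m, d i.succ = 1) (i : Fin m) :
    genericForm d i.succ = ∑ j, C (linCoeff d i j) * X j := by
  have h := isHomogeneous_genericForm d i.succ
  rw [hd] at h
  exact IsHomogeneous.eq_sum_C_mul_X h

theorem specializedForm_succ_eq (hd : ∀ i : Fin m, d i.succ = 1) {K : Type u} [Field K]
    (a : CoeffIndex d → K) (i : Fin m) : specializedForm d a i.succ =
      ∑ j, C ((linCoeff d).map (eval₂Hom (Int.castRingHom K) a) i j) * X j := by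
  rw [specializedForm, genericForm_succ_eq hd]
  simp

/-- The index of a coefficient of one of the linear forms. -/
noncomputable def linIndex (hd : ∀ i : Fin m, d i.succ = 1) (i : Fin m) (j : Fin (m + 1)) : CoeffIndex d :=
  ⟨i.succ, ⟨Finsupp.single j 1, mem_monoExps.2 (by rw [hd, Finsupp.degree_single])⟩⟩

theorem linIndex_injective2 (hd : ∀ i : Fin m, d i.succ = 1) :
    Function.Injective2 (linIndex hd) := by
  intro i i' j j' h
  obtain rfl : i = i' := Fin.succ_injective _ (congrArg Sigma.fst h)
  refine ⟨rfl, ?_⟩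
  have h2 := eq_of_heq (Sigma.mk.inj_iff.1 h).2
  exact (Finsupp.single_left_inj one_ne_zero).1 (congrArg Subtype.val h2)

theorem linCoeff_apply (hd : ∀ i : Fin m, d i.succ = 1) (i : Fin m) (j : Fin (m + 1)) :
    linCoeff d i j = X (linIndex hd i j) :=
  coeff_genericForm d i.succ ⟨Finsupp.single j 1, _⟩

theorem linDet_eq (hd : ∀ i : Fin m, d i.succ = 1) :
    linDet d = (Matrix.of fun i j => X (linIndex hd i j.succ)).det := by
  rw [← det_tailMatrix_linCoeff]
  exact congrArg Matrix.det (Matrix.ext fun i j => linCoeff_apply hd i j.succ)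

theorem irreducible_linDet (hm : 0 < m) (hd : ∀ i : Fin m, d i.succ = 1) :
    Irreducible (linDet d) := by
  rw [linDet_eq hd]
  refine irreducible_genericDet hm fun i i' j j' h => ?_
  obtain ⟨h1, h2⟩ := linIndex_injective2 hd h
  exact ⟨h1, Fin.succ_injective _ h2⟩

/-- The coefficients of the linear forms can be specialized at will, those of the first form
being zero. -/
theorem exists_specialization (hd : ∀ i : Fin m, d i.succ = 1)
    (A : Matrix (Fin m) (Fin (m + 1)) ℤ) :
    ∃ φ : CoeffRing d →+* ℤ, (linCoeff d).map φ = A := by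
  classical
  refine ⟨eval fun s => if h : ∃ p : Fin m × Fin (m + 1), s = linIndex hd p.1 p.2 then
    A h.choose.1 h.choose.2 else 0, ?_⟩
  ext i j
  have h : ∃ p : Fin m × Fin (m + 1), linIndex hd i j = linIndex hd p.1 p.2 := ⟨(i, j), rfl⟩
  rw [Matrix.map_apply, linCoeff_apply hd, eval_X, dif_pos h]
  obtain ⟨h1, h2⟩ := linIndex_injective2 hd h.choose_spec
  rw [← h1, ← h2]

theorem not_linDet_dvd_cramerSolution (hd : ∀ i : Fin m, d i.succ = 1) (k : Fin m) :
    ¬ linDet d ∣ cramerSolution (linCoeff d) k.succ := by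
  intro h
  -- Column `k` of the identity matrix is moved to the coefficients of x₁: δ becomes 0, while
  -- Cramer's rule restores the identity and gives -1.
  obtain ⟨φ, hφ⟩ := exists_specialization hd (Matrix.of fun i =>
    (Fin.cons (if i = k then 1 else 0) fun j => if j = k then 0 else if i = j then 1 else 0))
  have h1 := map_dvd φ h
  have hz : φ (linDet d) = 0 := by
    rw [← det_tailMatrix_map, hφ]
    refine Matrix.det_eq_zero_of_column_eq_zero k fun i => ?_
    simp [tailMatrix]
  have hq : φ (cramerSolution (linCoeff d) k.succ) = -1 := by
    rw [cramerSolution_succ, map_neg, Matrix.cramer_apply, RingHom.map_det]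
    have : φ.mapMatrix ((tailMatrix (linCoeff d)).updateCol k fun i => linCoeff d i 0) = 1 := by
      ext i j
      have hij := fun j => congrFun (congrFun hφ i) j
      rw [RingHom.mapMatrix_apply, Matrix.map_apply, Matrix.updateCol_apply]
      split_ifs with hjk
      · have := hij 0
        rw [Matrix.map_apply] at this
        rw [this, hjk]
        simp [Matrix.one_apply]
      · have := hij j.succ
        rw [Matrix.map_apply] at this
        rw [tailMatrix, Matrix.of_apply, this]
        simp [Matrix.one_apply, hjk]
    rw [this, Matrix.det_one]
  rw [hz, hq, zero_dvd_iff] at h1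
  norm_num at h1

theorem MultIndex.exists_succ (hν : ν < d 0) (b : MultIndex d ν) : ∃ i : Fin m, b.1 = i.succ := by
  have h0 : b.1 ≠ 0 := by
    intro h0
    have := b.le
    rw [h0] at this
    omega
  obtain ⟨i, hi⟩ := Fin.exists_succ_eq.2 h0
  exact ⟨i, hi.symm⟩

theorem eval_cramerSolution_monomial_mul (hd : ∀ i : Fin m, d i.succ = 1) (hν : ν < d 0)
    (b : MultIndex d ν) :
    eval (cramerSolution (linCoeff d)) (monomial b.2.1 1 * genericForm d b.1) = 0 := by
  obtain ⟨i, hi⟩ := b.exists_succ hν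
  have h : eval (cramerSolution (linCoeff d)) (genericForm d b.1) = 0 := by
    rw [hi, genericForm_succ_eq hd, map_sum]
    simp [sum_mul_cramerSolution]
  rw [map_mul, h, mul_zero]

theorem linDet_pow_dvd_macaulayMinor (hm : 0 < m) (hd : ∀ i : Fin m, d i.succ = 1)
    (hν0 : 0 < ν) (hν : ν < d 0) (f) :
    linDet d ^ ν ∣ macaulayMinor d ν {Finsupp.single 0 ν} f := by
  classical
  set q := cramerSolution (linCoeff d) with hq
  set M := macaulayMatrix d ν {Finsupp.single 0 ν} with hM
  let k : Fin m := ⟨0, hm⟩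
  let α₀ : {α : Fin (m + 1) →₀ ℕ // α ∈ monoExps (m + 1) ν \ {Finsupp.single 0 ν}} :=
    ⟨Finsupp.single k.succ ν, by
      rw [Finset.mem_sdiff, mem_monoExps, Finset.mem_singleton,
        Finsupp.single_left_inj (by omega)]
      exact ⟨Finsupp.degree_single _ _, Fin.succ_ne_zero k⟩⟩
  -- Each column is a form vanishing at q. Moving the term of x₁^ν, the only monomial without a row,
  -- to the other side leaves a multiple of q₁^ν = δ^ν.
  have hrow : ∀ b, ∑ α, (∏ j, q j ^ α.1 j) * M α b = linDet d ^ ν *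
      -coeff (Finsupp.single 0 ν) (monomial b.2.1 1 * genericForm d b.1) := by
    intro b
    have h1 := IsHomogeneous.eval_eq_sum_monoExps
      (isHomogeneous_monomial_mul (isHomogeneous_genericForm d) b) q
    have hmem : {Finsupp.single 0 ν} ⊆ monoExps (m + 1) ν := by
      rw [Finset.singleton_subset_iff, mem_monoExps, Finsupp.degree_single]
    rw [eval_cramerSolution_monomial_mul hd hν, ← Finset.sum_sdiff hmem, Finset.sum_singleton,
      Fin.prod_univ_succ] at h1
    have h2 : ∏ i : Fin m, q i.succ ^ (Finsupp.single (0 : Fin (m + 1)) ν) i.succ = 1 :=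
      Finset.prod_eq_one fun i _ => by simp
    rw [h2, mul_one, Finsupp.single_eq_same, hq, cramerSolution_zero,
      det_tailMatrix_linCoeff, ← Finset.sum_coe_sort] at h1
    have h3 : ∀ α, (∏ j, q j ^ α.1 j) * M α b =
        coeff α.1 (monomial b.2.1 1 * genericForm d b.1) * ∏ j, q j ^ α.1 j :=
      fun α => mul_comm _ _
    simp_rw [h3]
    linear_combination -h1
  -- Replacing row `α₀` by the weighted sum of all rows multiplies the minor by the weight of `α₀`,
  -- a power of a coordinate of q prime to δ.
  have hdet := Matrix.det_updateRow_sum (M.submatrix id f) α₀ fun α => ∏ j, q j ^ α.1 j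
  have hsum : ∑ α, (∏ j, q j ^ α.1 j) • M.submatrix id f α = linDet d ^ ν • fun β =>
      -coeff (Finsupp.single 0 ν) (monomial (f β).2.1 1 * genericForm d (f β).1) := by
    ext1 β
    rw [Finset.sum_apply]
    exact hrow (f β)
  rw [hsum, Matrix.det_updateRow_smul, smul_eq_mul] at hdet
  have hq0 : ∏ j, q j ^ α₀.1 j = q k.succ ^ ν := by
    rw [Finset.prod_eq_single k.succ]
    · simp [α₀]
    · intro j _ hj
      simp [α₀, hj]
    · simp
  rw [hq0] at hdet
  refine (irreducible_linDet hm hd).prime.pow_dvd_of_dvd_mul_left ν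
    (a := q k.succ ^ ν) ?_ ⟨_, hdet.symm⟩
  exact fun h => not_linDet_dvd_cramerSolution hd k
    ((irreducible_linDet hm hd).prime.dvd_of_dvd_pow h)

theorem dvd_linDet_pow_of_dvd_macaulayMinor (hd : ∀ i : Fin m, d i.succ = 1) {g : CoeffRing d}
    (hg : ∀ f, g ∣ macaulayMinor d ν {Finsupp.single 0 ν} f) : ∃ k, g ∣ linDet d ^ k := by
  classical
  have hI : ∀ i, ∑ j, C (linCoeff d i j) * X j ∈ Ideal.span (Set.range (genericForm d)) :=
    fun i => Ideal.subset_span ⟨i.succ, genericForm_succ_eq hd i⟩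
  choose r hr using fun γ : {α : Fin (m + 1) →₀ ℕ //
      α ∈ monoExps (m + 1) ν \ {Finsupp.single 0 ν}} =>
    exists_coeff_eq_sum_multIndex (isHomogeneous_genericForm d)
      (C_det_pow_mul_monomial_sub_mem (linCoeff d) hI (Finset.mem_sdiff.1 γ.2).1) ν
  -- The column `γ` of the right factor expresses δ^ν x^γ - q^γ x₁^ν through multiples of the forms;
  -- the second term is invisible, x₁^ν having no row.
  have key : macaulayMatrix d ν {Finsupp.single 0 ν} * (Matrix.of fun b γ => r γ b) =
      linDet d ^ ν • (1 : Matrix _ _ (CoeffRing d)) := by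
    ext1 α γ
    have h1 := hr γ α.1 (Finset.mem_sdiff.1 α.2).1
    have h2 : Finsupp.single 0 ν ≠ α.1 := fun h =>
      (Finset.mem_sdiff.1 α.2).2 (Finset.mem_singleton.2 h.symm)
    rw [coeff_sub, coeff_C_mul, coeff_C_mul, coeff_monomial, coeff_monomial, if_neg h2, mul_zero,
      sub_zero] at h1
    rw [Matrix.mul_apply, Matrix.smul_apply, Matrix.one_apply, smul_eq_mul]
    simp_rw [Subtype.ext_iff, eq_comm (a := α.1)]
    refine Eq.trans ?_ h1.symm
    exact Finset.sum_congr rfl fun b _ => mul_comm _ _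
  have := dvd_det_mul_of_forall_dvd_det_submatrix hg (Matrix.of fun b γ => r γ b)
  rw [key, Matrix.det_smul, Matrix.det_one, mul_one, ← pow_mul] at this
  exact ⟨_, this⟩

end LinearForms

section LinearForms

variable {m : ℕ} {d : Fin (m + 1) → ℕ} {ν : ℕ}

/-- Chooses a variable other than x₁ dividing the monomial, resorting to the one of index `k` only
if there is no other choice. This keeps the number of monomials assigned to `k` small. -/
theorem exists_succ_ne_zero {α : Fin (m + 1) →₀ ℕ}
    (hα : α ∈ monoExps (m + 1) ν \ {Finsupp.single 0 ν}) (k : Fin m) :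
    ∃ i : Fin m, α i.succ ≠ 0 ∧ (i = k → ∀ j, j ≠ k → α j.succ = 0) := by
  by_cases h : ∃ i, i ≠ k ∧ α i.succ ≠ 0
  · obtain ⟨i, hi, h0⟩ := h
    exact ⟨i, h0, fun h => absurd h hi⟩
  · push Not at h
    refine ⟨k, fun hk => ?_, fun _ => h⟩
    rw [Finset.mem_sdiff, mem_monoExps, Finset.mem_singleton, Finsupp.degree_eq_sum,
      Fin.sum_univ_succ] at hα
    have hs : ∀ i : Fin m, α i.succ = 0 := fun i => by
      by_cases hi : i = k
      · rw [hi, hk]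
      · exact h i hi
    simp only [hs, Finset.sum_const_zero, add_zero] at hα
    apply hα.2
    ext i
    refine Fin.cases ?_ (fun i => ?_) i
    · rw [hα.1, Finsupp.single_eq_same]
    · rw [hs, Finsupp.single_eq_of_ne (Fin.succ_ne_zero i)]

/-- A maximal minor of the Macaulay matrix which specializes to `2 ^ e`, `e ≤ ν`, when `δ`
specializes to `2`. -/
theorem exists_not_linDet_pow_dvd_macaulayMinor (hm : 0 < m) (hd : ∀ i : Fin m, d i.succ = 1)
    (hν0 : 0 < ν) : ∃ f, ¬ linDet d ^ (ν + 1) ∣ macaulayMinor d ν {Finsupp.single 0 ν} f := by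
  classical
  let k : Fin m := ⟨0, hm⟩
  let t : Fin m → ℤ := fun i => if i = k then 2 else 1
  choose ι hι hιk using fun α : {α : Fin (m + 1) →₀ ℕ //
    α ∈ monoExps (m + 1) ν \ {Finsupp.single 0 ν}} => exists_succ_ne_zero α.2 k
  have hle : ∀ α, Finsupp.single (ι α).succ 1 ≤ α.1 := fun α => by
    rw [Finsupp.single_le_iff]
    exact Nat.one_le_iff_ne_zero.2 (hι α)
  have hα : ∀ α, α.1 - Finsupp.single (ι α).succ 1 ∈
      if d (ι α).succ ≤ ν then monoExps (m + 1) (ν - d (ι α).succ) else ∅ := fun α => by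
    have h1 := congrArg Finsupp.degree (tsub_add_cancel_of_le (hle α))
    rw [map_add, Finsupp.degree_single, mem_monoExps.1 (Finset.mem_sdiff.1 α.2).1] at h1
    rw [hd, if_pos (by omega), mem_monoExps]
    omega
  refine ⟨fun α => ⟨(ι α).succ, _, hα α⟩, fun hdvd => ?_⟩
  -- The linear forms become 2x₂, x₃, …, xₙ, so δ becomes 2. The column chosen for α becomes a
  -- multiple of x^α alone, and the minor is diagonal.
  obtain ⟨φ, hφ⟩ := exists_specialization hd
    (Matrix.of fun i => (Fin.cons 0 fun j => if i = j then t i else 0))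
  have hδ : φ (linDet d) = 2 := by
    rw [← det_tailMatrix_map, hφ]
    have : tailMatrix (Matrix.of fun i => (Fin.cons 0 fun j => if i = j then t i else 0)) =
        Matrix.diagonal t := by
      ext i j
      simp [tailMatrix, Matrix.diagonal_apply]
    rw [this, Matrix.det_diagonal]
    simp [t]
  have hform : ∀ i : Fin m, map φ (genericForm d i.succ) = C (t i) * X i.succ := by
    intro i
    rw [genericForm_succ_eq hd, map_sum]
    simp_rw [map_mul, map_C, map_X]
    have h1 : ∀ j, φ (linCoeff d i j) =
        (Fin.cons 0 fun j => if i = j then t i else 0 : Fin (m + 1) → ℤ) j :=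
      fun j => congrFun (congrFun hφ i) j
    simp_rw [h1]
    rw [Fin.sum_univ_succ, Finset.sum_eq_single i]
    · simp
    · intro j _ hj
      simp [hj.symm]
    · simp
  have hminor : φ (macaulayMinor d ν {Finsupp.single 0 ν} fun α => ⟨(ι α).succ, _, hα α⟩) =
      ∏ α, t (ι α) := by
    rw [macaulayMinor, RingHom.map_det, ← Matrix.det_diagonal]
    congr 1
    ext1 α β
    have h1 : φ.mapMatrix ((macaulayMatrix d ν {Finsupp.single 0 ν}).submatrix id
        fun α => ⟨(ι α).succ, _, hα α⟩) α β = coeff α.1 (map φ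
        (monomial (β.1 - Finsupp.single (ι β).succ 1) 1 * genericForm d (ι β).succ)) := by
      rw [coeff_map]
      rfl
    rw [h1, map_mul, hform, map_monomial, map_one, mul_left_comm, coeff_C_mul, X, monomial_mul,
      tsub_add_cancel_of_le (hle β), coeff_monomial, Matrix.diagonal_apply]
    by_cases hαβ : α = β
    · simp [hαβ]
    · rw [if_neg hαβ, if_neg fun h => hαβ (Subtype.ext h.symm), mul_zero]
  have h2 := map_dvd φ hdvd
  rw [map_pow, hδ, hminor, Finset.prod_ite, Finset.prod_const, Finset.prod_const_one,
    mul_one] at h2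
  -- The factor 2 arises only from monomials x₁^a x₂^(ν - a) with a < ν, and there are `ν` of these.
  have hcard : (Finset.univ.filter fun α => ι α = k).card ≤ ν := by
    have hk : ∀ α ∈ Finset.univ.filter fun α => ι α = k, α.1 0 + α.1 k.succ = ν := by
      intro α hα
      have hz := hιk α (Finset.mem_filter.1 hα).2
      have hdeg := mem_monoExps.1 (Finset.mem_sdiff.1 α.2).1
      rw [Finsupp.degree_eq_sum, Fin.sum_univ_succ, Finset.sum_eq_single k] at hdeg
      · exact hdeg
      · exact fun j _ hj => hz j hj
      · simp
    refine le_of_le_of_eq ?_ (Finset.card_range ν)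
    refine Finset.card_le_card_of_injOn (fun α => α.1 0) ?_ ?_
    · intro α hα
      have h3 := hk α hα
      have h4 := hι α
      rw [(Finset.mem_filter.1 (Finset.mem_coe.1 hα)).2] at h4
      have h5 : α.1 0 < ν := by omega
      exact Finset.mem_coe.2 (Finset.mem_range.2 h5)
    · intro α hα β hβ hab
      have h3 := hk α hα
      have h4 := hk β hβ
      have hαz := hιk α (Finset.mem_filter.1 (Finset.mem_coe.1 hα)).2
      have hβz := hιk β (Finset.mem_filter.1 (Finset.mem_coe.1 hβ)).2
      replace hab : α.1 0 = β.1 0 := hab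
      ext i
      refine Fin.cases hab (fun i => ?_) i
      by_cases hi : i = k
      · rw [hi]
        omega
      · rw [hαz i hi, hβz i hi]
  have h5 := Int.le_of_dvd (by positivity) h2
  have h6 := (pow_le_pow_iff_right₀ (by norm_num : (1 : ℤ) < 2)).1 h5
  omega

theorem subresultant_singleton (hm : 0 < m) (hd : ∀ i : Fin m, d i.succ = 1)
    (hν0 : 0 < ν) (hν : ν < d 0) :
    subresultant d ν {Finsupp.single 0 ν} = linDet d ^ ν ∨
      subresultant d ν {Finsupp.single 0 ν} = -linDet d ^ ν := by
  apply eq_or_eq_neg_of_associated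
  have hp := (irreducible_linDet hm hd).prime
  obtain ⟨k, hk⟩ := dvd_linDet_pow_of_dvd_macaulayMinor (d := d) (ν := ν) hd
    subresultant_dvd_macaulayMinor
  obtain ⟨l, -, hl⟩ := (dvd_prime_pow hp k).1 hk
  obtain ⟨f, hf⟩ := exists_not_linDet_pow_dvd_macaulayMinor hm hd hν0
  have h1 : linDet d ^ ν ∣ linDet d ^ l :=
    (dvd_subresultant_iff.2 (linDet_pow_dvd_macaulayMinor hm hd hν0 hν)).trans hl.dvd
  have h2 : ν ≤ l := (pow_dvd_pow_iff hp.ne_zero hp.not_isUnit).1 h1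
  have h3 : l ≤ ν := by
    by_contra h
    exact hf ((pow_dvd_pow _ (by omega)).trans
      (hl.symm.dvd.trans (subresultant_dvd_macaulayMinor f)))
  rwa [le_antisymm h3 h2] at hl

theorem isWeightedHomogeneous_linDet (hd : ∀ i : Fin m, d i.succ = 1) (i₀ : Fin (m + 1)) :
    IsWeightedHomogeneous (fun c : CoeffIndex d => if c.1 = i₀ then (1 : ℤ) else 0) (linDet d)
      (∑ i : Fin m, if i.succ = i₀ then 1 else 0) := by
  rw [linDet_eq hd, Matrix.det_apply']
  refine IsWeightedHomogeneous.sum _ _ _ fun σ _ => ?_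
  rw [← map_intCast (C : ℤ →+* CoeffRing d)]
  refine IsWeightedHomogeneous.C_mul ?_ _
  -- Each Leibniz term has one entry from every row, but `Matrix.det_apply'` lists them by column,
  -- the row being `σ i`.
  rw [← Equiv.sum_comp σ]
  exact IsWeightedHomogeneous.prod _ _ _ fun i _ =>
    isWeightedHomogeneous_X ℤ _ (linIndex hd (σ i) i.succ)

theorem linDet_ne_zero_iff (hd : ∀ i : Fin m, d i.succ = 1) (hν0 : 0 < ν) (hν : ν < d 0)
    (K : Type u) [Field K] (a : CoeffIndex d → K) :
    eval₂Hom (Int.castRingHom K) a (linDet d) ≠ 0 ↔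
      ((Ideal.span (Set.range (specializedForm d a))).restrictScalars K ⊓
          homogeneousSubmodule (Fin (m + 1)) K ν) ⊔
        Submodule.span K ((fun α => monomial α (1 : K)) ''
          (({Finsupp.single 0 ν} : Finset (Fin (m + 1) →₀ ℕ)) : Set (Fin (m + 1) →₀ ℕ))) =
      homogeneousSubmodule (Fin (m + 1)) K ν := by
  set φ := eval₂Hom (Int.castRingHom K) a with hφ
  rw [← det_tailMatrix_map]
  have hmem : Finsupp.single 0 ν ∈ monoExps (m + 1) ν := by
    rw [mem_monoExps, Finsupp.degree_single]
  constructor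
  · intro hδ
    refine sup_span_eq_of_forall_monomial_mem (Finset.singleton_subset_iff.2 hmem)
      fun α hα => ?_
    have hI : ∀ i, ∑ j, C ((linCoeff d).map φ i j) * X j ∈
        Ideal.span (Set.range (specializedForm d a)) :=
      fun i => Ideal.subset_span ⟨i.succ, specializedForm_succ_eq hd a i⟩
    have h1 := C_det_pow_mul_monomial_sub_mem _ hI hα
    set δ := (tailMatrix ((linCoeff d).map φ)).det
    set r := ∏ j, cramerSolution ((linCoeff d).map φ) j ^ α j
    set g := C (δ ^ ν) * monomial α 1 - C r * monomial (Finsupp.single 0 ν) 1 with hg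
    have hgh : g.IsHomogeneous ν :=
      ((isHomogeneous_monomial _ (mem_monoExps.1 hα)).C_mul _).sub
        ((isHomogeneous_monomial _ (mem_monoExps.1 hmem)).C_mul _)
    have h2 : monomial α (1 : K) =
        (δ ^ ν)⁻¹ • (g + r • monomial (Finsupp.single 0 ν) (1 : K)) := by
      rw [eq_inv_smul_iff₀ (pow_ne_zero _ hδ), hg, smul_eq_C_mul, smul_eq_C_mul,
        sub_add_cancel]
    rw [h2]
    refine Submodule.smul_mem _ _ (Submodule.add_mem _ (Submodule.mem_sup_left ⟨h1, hgh⟩)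
      (Submodule.smul_mem _ _ (Submodule.mem_sup_right (Submodule.subset_span ⟨_, ?_, rfl⟩))))
    exact Finset.mem_coe.2 (Finset.mem_singleton_self _)
  · contrapose!
    intro hδ
    obtain ⟨v, hv0, hv⟩ := Matrix.exists_mulVec_eq_zero_iff.2 hδ
    -- A kernel vector of the specialized tail matrix gives a common zero of the linear forms with
    -- x₁ = 0, where x₁^ν vanishes but some xⱼ^ν does not.
    refine sup_span_ne_of_eval_eq_zero (Fin.cons 0 v) ?_ ?_ ?_
    · refine Fin.cases (fun h => by omega) fun i _ => ?_
      rw [specializedForm_succ_eq hd, map_sum, Fin.sum_univ_succ]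
      have := congrFun hv i
      simpa [Matrix.mulVec, dotProduct, tailMatrix, hφ] using this
    · intro α hα
      rw [Finset.mem_singleton.1 hα, eval_monomial]
      simp [hν0.ne']
    · obtain ⟨j, hj⟩ := Function.ne_iff.1 hv0
      refine ⟨Finsupp.single j.succ ν, mem_monoExps.2 (Finsupp.degree_single _ _), ?_⟩
      rw [eval_monomial]
      simpa [hν0.ne'] using hj

theorem hasSubresultantProperties_singleton (hm : 0 < m) (hd : ∀ i : Fin m, d i.succ = 1)
    (hν0 : 0 < ν) (hν : d 0 = ν + 1) :
    HasSubresultantProperties.{u} d ν {Finsupp.single 0 ν}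
      (subresultant d ν {Finsupp.single 0 ν}) := by
  have hpow := subresultant_singleton hm hd hν0 (by omega : ν < d 0)
  constructor
  · intro i
    have hw : IsWeightedHomogeneous (fun c : CoeffIndex d => if c.1 = i then (1 : ℤ) else 0)
        (linDet d ^ ν) (hilbertCI d (Finset.univ.erase i) ((ν : ℤ) - d i)) := by
      convert (isWeightedHomogeneous_linDet hd i).pow ν using 1
      refine Fin.cases ?_ (fun i => ?_) i
      · rw [hilbertCI_of_neg _ _ (by omega)]
        simp
      · rw [hilbertCI_linear_erase_succ hd hν0 (by omega)]
        simp
    rcases hpow with hp | hp <;> rw [hp]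
    · exact hw
    · exact hw.neg
  · intro K _ a
    rw [← linDet_ne_zero_iff hd hν0 (by omega : ν < d 0)]
    rcases hpow with hp | hp <;> rw [hp] <;> simp [hν0.ne']

end LinearForms

/-! ### The two families of examples -/

theorem mainTheorem3 :
    -- two forms of degrees `d 0 > d 1 ≥ 1`; `S = {x₁ ^ k * x₂ ^ (ν - k) : k < d 1}`
    (∀ (d : Fin 2 → ℕ) (ν : ℕ), 1 ≤ d 1 → d 1 < d 0 →
      (ν : ℤ) = rho d - ((⨅ i, d i : ℕ) : ℤ) + 1 →
      let S : Finset (Fin 2 →₀ ℕ) := (monoExps 2 ν).filter (fun α => α 0 < d 1)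
      let Δ : CoeffRing d := subresultant d ν S
      let c₀ : CoeffRing d := coeff (Finsupp.single 0 (d 1)) (genericForm d 1)
      (S.card : ℤ) = hilbertCI d Finset.univ ν ∧
      HasSubresultantProperties.{u} d ν S Δ ∧
      (Δ = c₀ ^ (d 0 - d 1) ∨ Δ = -c₀ ^ (d 0 - d 1)) ∧
      (d 1 < d 0 - 1 → IsReducible Δ)) ∧
    -- `n = m + 1 > 2` forms, the last `m` of them linear; `S = {x₁ ^ ν}`
    (∀ (m : ℕ) (d : Fin (m + 1) → ℕ) (ν : ℕ), 2 < m + 1 → 1 < d 0 - 1 →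
      (∀ i : Fin m, d i.succ = 1) →
      (ν : ℤ) = rho d - ((⨅ i, d i : ℕ) : ℤ) + 1 →
      let S : Finset (Fin (m + 1) →₀ ℕ) := {Finsupp.single 0 ν}
      let Δ : CoeffRing d := subresultant d ν S
      let δ : CoeffRing d := (Matrix.of fun i j : Fin m =>
        coeff (Finsupp.single j.succ 1) (genericForm d i.succ)).det
      (S.card : ℤ) = hilbertCI d Finset.univ ν ∧
      HasSubresultantProperties.{u} d ν S Δ ∧
      (Δ = δ ^ ν ∨ Δ = -δ ^ ν) ∧
      IsReducible Δ) := by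
  refine ⟨?_, ?_⟩
  · intro d ν h1 h2 hν S Δ c₀
    have hinf : (⨅ i, d i) = d 1 := by
      refine le_antisymm (ciInf_le (OrderBot.bddBelow _) 1) (le_ciInf fun i => ?_)
      fin_cases i
      · exact h2.le
      · exact le_rfl
    rw [hinf, rho, Fin.sum_univ_two] at hν
    -- The minimum is `d 1`, so ρ - d 1 + 1 = d 0 - 1.
    have hν' : d 0 = ν + 1 := by omega
    have hle : d 1 ≤ ν := by omega
    have hpow : Δ = c₀ ^ (d 0 - d 1) ∨ Δ = -c₀ ^ (d 0 - d 1) := by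
      rw [hν']
      exact subresultant_lowExps (by omega)
    refine ⟨?_, hasSubresultantProperties_lowExps hle hν', hpow, fun h3 => ?_⟩
    · rw [hilbertCI_two_univ hle (by omega), card_filter_lt_monoExps_two hle]
    · have hX : Irreducible c₀ := by
        have : c₀ = X _ := leadCoeff_eq_X d
        rw [this]
        exact X_prime.irreducible
      exact isReducible_of_eq_pow hpow hX.ne_zero hX.not_isUnit (by omega)
  · intro m d ν hm h0 hd hν S Δ δ
    have hinf : (⨅ i, d i) = 1 := by
      refine le_antisymm ?_ (le_ciInf fun i => ?_)
      · exact (ciInf_le (OrderBot.bddBelow _) _).trans_eq (hd ⟨0, by omega⟩)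
      · refine Fin.cases (by omega) (fun i => (hd i).ge) i
    rw [hinf, rho, Fin.sum_univ_succ] at hν
    simp only [hd, Nat.cast_one, sub_self, Finset.sum_const_zero, add_zero] at hν
    have hν' : d 0 = ν + 1 := by omega
    have hpow : Δ = δ ^ ν ∨ Δ = -δ ^ ν :=
      subresultant_singleton (by omega) hd (by omega) (by omega)
    refine ⟨?_, hasSubresultantProperties_singleton (by omega) hd (by omega) hν', hpow, ?_⟩
    · rw [hilbertCI_linear_univ hd (by omega), Finset.card_singleton, Nat.cast_one]
    · have hδ : Irreducible δ := irreducible_linDet (by omega) hd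
      exact isReducible_of_eq_pow hpow hδ.ne_zero hδ.not_isUnit (by omega)
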